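/- Let $J=[-1,1]$, and let $D^2\subset\mathbb R^2$ be the closed unit disc. **Spaces.** $EC(1,D^2)$ is the space of smooth embeddings $f:\mathbb R\times D^2\to\mathbb R\times D^2$ that are the identity outside $J\times D^2$. Let $\iota:D^2\amalg D^2\to D^2$ be given by $x\mapsto \tfrac18x+(0,\pm\tfrac12)$ ($+$ on the first, upper, copy). $EC_\iota(1,D^2)$ is the space of smooth embeddings $(\mathbb R\times D^2)\amalg(\mathbb R\times D^2)\to\mathbb R\times D^2$ that agree with $\mathrm{id}_{\mathbb R}\times\iota$ outside $(J\times D^2)^{\amalg 2}$ and map $((-1,1)\times D^2)^{\amalg 2}$ into $(-1,1)\times D^2$. Both carry the $C^\infty$-topology (uniform convergence of all derivatives on compact sets). **The operad.** A little interval is a map $l(x)=ax+b$, $a>0$, with $l(J)\subset J$; a little square is a product $L=l^1\times l^2$ of two of them, and we write $L_\pi=l^1$, $L_t=l^2(-1)$. It meets the lower face if $l^2(-1)=-1$. Two squares are almost disjoint if the interiors of their images are disjoint. Configurations of squares are topologized by the coefficients $a,b$. The operad $\mathrm{SCL}$ has the colours $o,\uparrow,\downarrow,\updownarrow$. For $s\ne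 o$, $\mathrm{SCL}(\underline t;s)$ is empty unless $\underline t=s^n$, and $\mathrm{SCL}(s^n;s)$ is the space of $n$-tuples of pairwise almost disjoint little squares. $\mathrm{SCL}(\underline t;o)$ is the space of tuples $L=(L^1,\dots,L^{|\underline t|})$ of little squares such that each $L^i$ with $t_i=o$ meets the lower face and is almost disjoint from every other square, and, for each $s\in\{\uparrow,\downarrow,\updownarrow\}$, the squares of colour $s$ are pairwise almost disjoint. Permutations act by $L\sigma=(L^{\sigma(1)},L^{\sigma(2)},\dots)$, the units are the identity squares, and $L\circ_iP$ replaces $L^i$ by the squares $L^i\circ P^1,\dots,L^i\circ P^m$, where $m$ is the number of squares of $P$. **The operations.** For a little interval $l$ put $lf=(l\times\mathrm{id})\circ f\circ(l^{-1}\times\mathrm{id})$ for $f\in EC(1,D^2)$, and $lf=(l\times\mathrm{id})\circ f\circ(l^{-1}\times\mathrm{id})^{\amalg2}$ for $f\in EC_\iota(1,D^2)$, where $l$ is extended to $\mathbb R$. For pairwise almost disjoint squares $L^1,\dots,L^k$, consider the partial order on the indices generated by: $i<j$ if $L^i_t<L^j_t$ and the interiors of the images of $L^i_\pi$ and $L^j_\pi$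 intersect. A permutation $\sigma$ orders $L$ if $\sigma(1),\dots,\sigma(k)$ is a linear extension of this order. Budney's action is $$\kappa(L)(f_1,\dots,f_k)=(L^{\sigma(1)}_\pi f_{\sigma(1)})\circ\cdots\circ(L^{\sigma(k)}_\pi f_{\sigma(k)})$$ for $\sigma$ ordering $L$; the reverse action $\kappa^{\mathrm{rev}}$ is given by the same formula with $\sigma$ a linear extension of the opposite order. For little intervals $l_1,\dots,l_k$ with pairwise disjoint interiors, Burke–Koytcheff's action is: $\lambda(l)(f_1,\dots,f_k)$ equals $l_if_i$ over $l_i(J)\times D^2$ (in both copies), and $\mathrm{id}_{\mathbb R}\times\iota$ elsewhere. For $k=0$, $\kappa$ and $\kappa^{\mathrm{rev}}$ are the identity and $\lambda$ is $\mathrm{id}_{\mathbb R}\times\iota$. Let $X=(X_o,X_\uparrow,X_\downarrow,X_\updownarrow)=(EC_\iota(1,D^2),EC(1,D^2),EC(1,D^2),EC(1,D^2))$. The operations $\mu$ are: $\mu_{(s^k;s)}=\kappa$ for $s\in\{\uparrow,\downarrow\}$; $\mu_{(\updownarrow^k;\updownarrow)}=\kappa^{\mathrm{rev}}$; and for $L\in\mathrm{SCL}(\underline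 t;o)$, $\mathbf f\in X^{\times\underline t}=\prod_iX_{t_i}$, $$\mu_{(\underline t;o)}(L)(\mathbf f)=\kappa^{\mathrm{rev}}(\alpha_\updownarrow L)(\alpha_\updownarrow\mathbf f)\circ\lambda((\alpha_oL)_\pi)(\alpha_o\mathbf f)\circ\big[\kappa(\alpha_\uparrow L)(\alpha_\uparrow\mathbf f)\amalg\kappa(\alpha_\downarrow L)(\alpha_\downarrow\mathbf f)\big],$$ where $\alpha_s$ selects the squares, respectively the entries, of colour $s$, listed in any order (the same for squares and entries). In particular $\mu_{(o^k;o)}(L)=\lambda(L_\pi)$. **Theorem.** The operations $\mu$ are well defined: the maps above lie in the spaces indicated, and they do not depend on the choices of ordering permutations and of the listings $\alpha_s$. They are continuous as maps $\mathrm{SCL}(\underline t;s)\times X^{\times\underline t}\to X_s$, and they make $X$ an algebra over the four-coloured operad $\mathrm{SCL}$, i.e. they preserve units, symmetric actions and operadic compositions. -/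

import Mathlib

open scoped ContDiff Topology

noncomputable section

namespace SCLinks

/-! ## Tuples and insertion of a tuple at the `i`-th place -/

/-- The positions of a tuple `t ∘ᵢ u`, where `t` has length `n` and `u` has length `m`: such a
position is either a position `j ≠ i` of `t` or a position of `u`. The positions `j < i` of `t` are
unchanged, those of `u` are shifted by `i`, and the positions `j > i` of `t` are shifted by `m - 1`. -/
def slot {n : ℕ} (i : Fin n) (m : ℕ) : {j : Fin n // j ≠ i} ⊕ Fin m ≃ Fin (n + m - 1) where
  toFun := Sum.elim
    (fun j => if h : j.1.1 < i.1 then ⟨j.1.1, by omega⟩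
      else ⟨j.1.1 + m - 1, by have := j.1.2; have := Fin.val_ne_of_ne j.2; omega⟩)
    (fun r => ⟨i.1 + r.1, by omega⟩)
  invFun k :=
    if h : k.1 < i.1 then Sum.inl ⟨⟨k.1, by omega⟩, Fin.ne_of_val_ne (by simp; omega)⟩
    else if h' : k.1 < i.1 + m then Sum.inr ⟨k.1 - i.1, by omega⟩
    else Sum.inl ⟨⟨k.1 - m + 1, by omega⟩, Fin.ne_of_val_ne (by simp; omega)⟩
  left_inv := by
    rintro (⟨j, hj⟩ | r)
    · have hj' := Fin.val_ne_of_ne hj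
      by_cases h : j.1 < i.1
      · simp only [Sum.elim_inl, h, dif_pos]
      · have h1 : ¬ (j.1 + m - 1 < i.1) := by omega
        have h2 : ¬ (j.1 + m - 1 < i.1 + m) := by omega
        simp only [Sum.elim_inl, h, h1, h2, dif_neg, not_false_eq_true]
        congr 2
        apply Fin.ext
        simp only
        omega
    · have h1 : ¬ (i.1 + r.1 < i.1) := by omega
      have h2 : i.1 + r.1 < i.1 + m := by omega
      simp [h1]
  right_inv := by
    intro k
    have hk := k.2
    by_cases h : k.1 < i.1
    · simp only [h, dif_pos, Sum.elim_inl]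
    · by_cases h' : k.1 < i.1 + m
      · simp only [h, h', dif_neg, dif_pos, not_false_eq_true, Sum.elim_inr]
        apply Fin.ext
        simp only
        omega
      · have h3 : ¬ (k.1 - m + 1 < i.1) := by omega
        simp only [h, h', dif_neg, not_false_eq_true, Sum.elim_inl, h3]
        apply Fin.ext
        simp only
        omega

/-- The tuple `t ∘ᵢ u = (t₁, …, tᵢ₋₁, u₁, …, uₘ, tᵢ₊₁, …, tₙ)`. -/
def insertAt {α : Type*} {n m : ℕ} (t : Fin n → α) (i : Fin n) (u : Fin m → α) :
    Fin (n + m - 1) → α :=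
  fun k => Sum.elim (fun j : {j : Fin n // j ≠ i} => t j.1) u ((slot i m).symm k)

theorem insertAt_slot {α : Type*} {n m : ℕ} (t : Fin n → α) (i : Fin n) (u : Fin m → α)
    (z : {j : Fin n // j ≠ i} ⊕ Fin m) :
    insertAt t i u (slot i m z) = Sum.elim (fun j : {j : Fin n // j ≠ i} => t j.1) u z := by
  simp [insertAt]

theorem insertAt_apply {α : Type*} {n m : ℕ} (t : Fin n → α) (i : Fin n) (u : Fin m → α)
    (k : Fin (n + m - 1)) :
    insertAt t i u k = if h : k.1 < i.1 then t ⟨k.1, by omega⟩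
      else if h' : k.1 < i.1 + m then u ⟨k.1 - i.1, by omega⟩
      else t ⟨k.1 - m + 1, by omega⟩ := by
  simp only [insertAt, slot, Equiv.coe_fn_symm_mk]
  split_ifs <;> rfl

theorem slot_inl_val {n m : ℕ} (i : Fin n) (j : {j : Fin n // j ≠ i}) :
    (slot i m (Sum.inl j)).1 = if j.1.1 < i.1 then j.1.1 else j.1.1 + m - 1 := by
  simp only [slot, Equiv.coe_fn_mk, Sum.elim_inl]
  split_ifs <;> rfl

theorem slot_inr_val {n m : ℕ} (i : Fin n) (r : Fin m) :
    (slot i m (Sum.inr r)).1 = i.1 + r.1 := rfl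

theorem insertAt_seq {α : Type*} {n m l : ℕ} (t : Fin n → α) (i : Fin n) (u : Fin m → α)
    (j : Fin m) (v : Fin l → α) (h : n + m - 1 + l - 1 = n + (m + l - 1) - 1)
    (k : Fin (n + m - 1 + l - 1)) :
    insertAt (insertAt t i u) (slot i m (Sum.inr j)) v k =
      insertAt t i (insertAt u j v) (Fin.cast h k) := by
  have hi := i.2
  have hj := j.2
  have hk := k.2
  simp only [insertAt_apply, slot_inr_val, Fin.val_cast]
  split_ifs <;> first | omega | (congr 1; apply Fin.ext; simp only; omega) | rfl

theorem insertAt_par {α : Type*} {n m l : ℕ} (t : Fin n → α) (i k : Fin n) (hik : i ≠ k)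
    (u : Fin m → α) (v : Fin l → α) (h : n + m - 1 + l - 1 = n + l - 1 + m - 1)
    (p : Fin (n + m - 1 + l - 1)) :
    insertAt (insertAt t i u) (slot i m (Sum.inl ⟨k, hik.symm⟩)) v p =
      insertAt (insertAt t k v) (slot k l (Sum.inl ⟨i, hik⟩)) u (Fin.cast h p) := by
  have hi := i.2
  have hk := k.2
  have hp := p.2
  have hne := Fin.val_ne_of_ne hik
  simp only [insertAt_apply, slot_inl_val, Fin.val_cast]
  by_cases hlt : k.1 < i.1
  · have hlt' : ¬ i.1 < k.1 := by omega
    simp only [hlt, hlt', if_true, if_false]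
    repeat' split
    all_goals first | omega | (congr 1; apply Fin.ext; simp only; omega) | rfl
  have hlt' : i.1 < k.1 := by omega
  simp only [hlt, hlt', if_true, if_false]
  repeat' split
  all_goals first | omega | (congr 1; apply Fin.ext; simp only; omega) | rfl

theorem insertAt_unit_left {α : Type*} {n : ℕ} (x : Fin 1 → α) (u : Fin n → α)
    (h : 1 + n - 1 = n) (k : Fin (1 + n - 1)) : insertAt x 0 u k = u (Fin.cast h k) := by
  have hk := k.2
  simp only [insertAt_apply, Fin.val_zero]
  split_ifs <;> first | omega | (congr 1)

theorem insertAt_unit_right {α : Type*} {n : ℕ} (t : Fin n → α) (i : Fin n) (x : Fin 1 → α)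
    (hx : x 0 = t i) (k : Fin (n + 1 - 1)) : insertAt t i x k = t (Fin.cast rfl k) := by
  have hk := k.2
  simp only [insertAt_apply]
  split_ifs with h1 h2
  · rfl
  · have h0 : (⟨k.1 - i.1, by omega⟩ : Fin 1) = 0 := Subsingleton.elim _ _
    rw [h0, hx]; congr 1; apply Fin.ext; simp only [Fin.val_cast]; omega
  · congr 1; apply Fin.ext; simp only [Fin.val_cast]; omega

/-- Insertion for tuples of elements of a family `X`, with colours `t` and `u`. -/
def insertDep {S : Type*} {X : S → Type*} {n m : ℕ} {t : Fin n → S} {u : Fin m → S}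
    (y : ∀ j, X (t j)) (i : Fin n) (w : ∀ r, X (u r)) : ∀ k, X (insertAt t i u k) :=
  fun k => Sum.rec
    (motive := fun z => X (Sum.elim (fun j : {j : Fin n // j ≠ i} => t j.1) u z))
    (fun j => y j.1) w ((slot i m).symm k)

/-- The block permutation `σ ∘ᵢ τ`: the positions of the inserted block are permuted by `τ`, and the
block is moved by `σ` as if it were the single position `i`. -/
def blockPerm {n m : ℕ} (σ : Equiv.Perm (Fin n)) (i : Fin n) (τ : Equiv.Perm (Fin m)) :
    Equiv.Perm (Fin (n + m - 1)) :=
  ((slot i m).symm.trans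
    (Equiv.sumCongr (σ.subtypeEquiv (fun _ => σ.injective.ne_iff.symm)) τ)).trans (slot (σ i) m)

theorem insertAt_blockPerm {α : Type*} {n m : ℕ} (t : Fin n → α) (u : Fin m → α)
    (σ : Equiv.Perm (Fin n)) (i : Fin n) (τ : Equiv.Perm (Fin m)) (k : Fin (n + m - 1)) :
    insertAt (t ∘ σ) i (u ∘ τ) k = insertAt t (σ i) u (blockPerm σ i τ k) := by
  obtain ⟨z, rfl⟩ := (slot i m).surjective k
  simp only [blockPerm, Equiv.trans_apply, Equiv.symm_apply_apply, insertAt_slot]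
  rcases z with z | z <;> rfl

/-! ## Coloured operads and their algebras -/

/-- A (symmetric, topological) coloured operad with set of colours `S`, presented by partial
compositions. `Op t s` is the space of operations with inputs `t` and output `s`. Equalities between
operations whose input tuples agree only up to an identity of tuples are written with `HEq`. -/
structure ColoredOperad (S : Type) where
  Op : ∀ {n : ℕ}, (Fin n → S) → S → Type
  top : ∀ {n : ℕ} (t : Fin n → S) (s : S), TopologicalSpace (Op t s)
  /-- the right action `a ↦ aσ` of permutations -/
  act : ∀ {n : ℕ} {t : Fin n → S} {s : S} (σ : Equiv.Perm (Fin n)), Op t s → Op (t ∘ σ) s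
  unit : ∀ s : S, Op (fun _ : Fin 1 => s) s
  /-- the partial composition `a ∘ᵢ b` -/
  comp : ∀ {n m : ℕ} {t : Fin n → S} {u : Fin m → S} {s : S} (i : Fin n),
    Op t s → Op u (t i) → Op (insertAt t i u) s
  continuous_act : ∀ {n : ℕ} {t : Fin n → S} {s : S} (σ : Equiv.Perm (Fin n)),
    Continuous (act σ : Op t s → Op (t ∘ σ) s)
  continuous_comp : ∀ {n m : ℕ} {t : Fin n → S} {u : Fin m → S} {s : S} (i : Fin n),
    Continuous (fun p : Op t s × Op u (t i) => comp i p.1 p.2)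
  act_one : ∀ {n : ℕ} {t : Fin n → S} {s : S} (a : Op t s), act 1 a = a
  act_act : ∀ {n : ℕ} {t : Fin n → S} {s : S} (σ τ : Equiv.Perm (Fin n)) (a : Op t s),
    act τ (act σ a) = act (σ * τ) a
  unit_comp : ∀ {n : ℕ} {t : Fin n → S} {s : S} (a : Op t s), HEq (comp 0 (unit s) a) a
  comp_unit : ∀ {n : ℕ} {t : Fin n → S} {s : S} (a : Op t s) (i : Fin n),
    HEq (comp i a (unit (t i))) a
  /-- sequential associativity `(a ∘ᵢ b) ∘ c = a ∘ᵢ (b ∘ⱼ c)` -/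
  comp_seq : ∀ {n m l : ℕ} {t : Fin n → S} {u : Fin m → S} {v : Fin l → S} {s : S}
    (i : Fin n) (j : Fin m) (a : Op t s) (b : Op u (t i)) (c : Op v (u j))
    (c' : Op v (insertAt t i u (slot i m (Sum.inr j)))), HEq c' c →
    HEq (comp (slot i m (Sum.inr j)) (comp i a b) c') (comp i a (comp j b c))
  /-- parallel associativity `(a ∘ᵢ b) ∘ c = (a ∘ₖ c) ∘ b` for `i ≠ k` -/
  comp_par : ∀ {n m l : ℕ} {t : Fin n → S} {u : Fin m → S} {v : Fin l → S} {s : S}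
    (i k : Fin n) (hik : i ≠ k) (a : Op t s) (b : Op u (t i)) (c : Op v (t k))
    (b' : Op u (insertAt t k v (slot k l (Sum.inl ⟨i, hik⟩))))
    (c' : Op v (insertAt t i u (slot i m (Sum.inl ⟨k, hik.symm⟩)))), HEq b' b → HEq c' c →
    HEq (comp (slot i m (Sum.inl ⟨k, hik.symm⟩)) (comp i a b) c')
      (comp (slot k l (Sum.inl ⟨i, hik⟩)) (comp k a c) b')
  /-- equivariance `aσ ∘ᵢ bτ = (a ∘_{σ(i)} b)(σ ∘ᵢ τ)` -/
  comp_act : ∀ {n m : ℕ} {t : Fin n → S} {u : Fin m → S} {s : S} (σ : Equiv.Perm (Fin n))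
    (τ : Equiv.Perm (Fin m)) (i : Fin n) (a : Op t s) (b : Op u (t (σ i))),
    HEq (comp (t := t ∘ σ) i (act σ a) (act τ b)) (act (blockPerm σ i τ) (comp (σ i) a b))

attribute [instance] ColoredOperad.top

/-- An algebra over the coloured operad `O` on the family of spaces `X`: continuous maps
`O(t; s) × X^t → X_s` that preserve units, symmetric actions and partial compositions. -/
@[ext]
structure OperadAlgebra {S : Type} (O : ColoredOperad S) (X : S → Type)
    [∀ s, TopologicalSpace (X s)] where
  map : ∀ {n : ℕ} {t : Fin n → S} {s : S}, O.Op t s → (∀ i, X (t i)) → X s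
  continuous_map : ∀ {n : ℕ} {t : Fin n → S} {s : S},
    Continuous (fun p : O.Op t s × (∀ i, X (t i)) => map p.1 p.2)
  map_unit : ∀ (s : S) (x : Fin 1 → X s), map (O.unit s) x = x 0
  map_act : ∀ {n : ℕ} {t : Fin n → S} {s : S} (σ : Equiv.Perm (Fin n)) (a : O.Op t s)
    (x : ∀ i, X (t i)), map (O.act σ a) (fun i => x (σ i)) = map a x
  /-- `(a ∘ᵢ b)(x) = a(x₁, …, xᵢ₋₁, b(xᵢ, …, xᵢ₊ₘ₋₁), xᵢ₊ₘ, …)`: here `w` is the inserted block and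
  `y` is the tuple that is fed into `a`. -/
  map_comp : ∀ {n m : ℕ} {t : Fin n → S} {u : Fin m → S} {s : S} (i : Fin n)
    (a : O.Op t s) (b : O.Op u (t i)) (y : ∀ j, X (t j)) (w : ∀ r, X (u r)),
    y i = map b w → map (O.comp i a b) (insertDep y i w) = map a y

/-! ## Little cubes -/

/-- A little interval: an increasing affine map `x ↦ a x + b` that sends `J = [-1, 1]` to itself. -/
@[ext]
structure LittleInterval where
  a : ℝ
  b : ℝ
  pos : 0 < a
  lower : -1 ≤ -a + b
  upper : a + b ≤ 1

namespace LittleInterval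

instance : TopologicalSpace LittleInterval :=
  TopologicalSpace.induced (fun l => (l.a, l.b)) inferInstance

/-- The affine map of `ℝ` attached to a little interval. -/
def app (l : LittleInterval) (x : ℝ) : ℝ := l.a * x + l.b

/-- The inverse affine map. -/
def inv (l : LittleInterval) (x : ℝ) : ℝ := (x - l.b) / l.a

/-- The image of `J`. -/
def image (l : LittleInterval) : Set ℝ := l.app '' Set.Icc (-1) 1

def one : LittleInterval := ⟨1, 0, one_pos, by norm_num, by norm_num⟩

def comp (l p : LittleInterval) : LittleInterval where
  a := l.a * p.a
  b := l.a * p.b + l.b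
  pos := mul_pos l.pos p.pos
  lower := by nlinarith [l.pos, p.lower, l.lower]
  upper := by nlinarith [l.pos, p.upper, l.upper]

end LittleInterval

/-- A little `n`-cube `l¹ × ⋯ × lⁿ`. -/
abbrev LittleCube (n : ℕ) := Fin n → LittleInterval

namespace LittleCube

/-- The image of `Jⁿ`. -/
def image {n : ℕ} (L : LittleCube n) : Set (Fin n → ℝ) :=
  (fun (x : Fin n → ℝ) j => (L j).app (x j)) '' {x : Fin n → ℝ | ∀ j, x j ∈ Set.Icc (-1) 1}

def AlmostDisjoint {n : ℕ} (L P : LittleCube n) : Prop :=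
  Disjoint (interior L.image) (interior P.image)

def one (n : ℕ) : LittleCube n := fun _ => LittleInterval.one

def comp {n : ℕ} (L P : LittleCube n) : LittleCube n := fun j => (L j).comp (P j)

/-- The little square meets the lower face `J × {-1}`. -/
def MeetsLowerFace (L : LittleCube 2) : Prop := (L 1).app (-1) = -1

/-- The projection `L_π` of a little square to its first factor. -/
def proj (L : LittleCube 2) : LittleInterval := L 0

/-- The height `L_t` of the lower side of a little square. -/
def height (L : LittleCube 2) : ℝ := (L 1).app (-1)

theorem AlmostDisjoint.symm {n : ℕ} {L P : LittleCube n} (h : AlmostDisjoint L P) :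
    AlmostDisjoint P L := Disjoint.symm h

theorem app_comp (l p : LittleInterval) (x : ℝ) : (l.comp p).app x = l.app (p.app x) := by
  simp only [LittleInterval.app, LittleInterval.comp]; ring

theorem app_mem (p : LittleInterval) {x : ℝ} (hx : x ∈ Set.Icc (-1 : ℝ) 1) :
    p.app x ∈ Set.Icc (-1 : ℝ) 1 := by
  have h1 := p.pos
  have h2 := p.lower
  have h3 := p.upper
  obtain ⟨h4, h5⟩ := hx
  constructor <;> simp only [LittleInterval.app] <;> nlinarith

/-- The affine homeomorphism of `ℝⁿ` that extends a little cube. -/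
def homeo {n : ℕ} (L : LittleCube n) : (Fin n → ℝ) ≃ₜ (Fin n → ℝ) where
  toFun x j := (L j).app (x j)
  invFun x j := (L j).inv (x j)
  left_inv x := by
    funext j
    have := (L j).pos.ne'
    simp only [LittleInterval.app, LittleInterval.inv]; field_simp; ring
  right_inv x := by
    funext j
    have := (L j).pos.ne'
    simp only [LittleInterval.app, LittleInterval.inv]; field_simp; ring
  continuous_toFun := by unfold LittleInterval.app; fun_prop
  continuous_invFun := by unfold LittleInterval.inv; fun_prop

theorem image_comp {n : ℕ} (L P : LittleCube n) : (L.comp P).image = L.homeo '' P.image := by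
  simp only [image, Set.image_image]
  refine Set.image_congr fun x _ => ?_
  funext j
  exact app_comp _ _ _

theorem image_comp_subset {n : ℕ} (L P : LittleCube n) : (L.comp P).image ⊆ L.image := by
  rintro _ ⟨x, hx, rfl⟩
  exact ⟨fun j => (P j).app (x j), fun j => app_mem _ (hx j), by
    funext j; exact (app_comp _ _ _).symm⟩

theorem AlmostDisjoint.comp_right {n : ℕ} {L M : LittleCube n} (h : AlmostDisjoint M L)
    (P : LittleCube n) : AlmostDisjoint M (L.comp P) :=
  Disjoint.mono_right (interior_mono (image_comp_subset L P)) h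

theorem AlmostDisjoint.comp_left {n : ℕ} {P Q : LittleCube n} (h : AlmostDisjoint P Q)
    (L : LittleCube n) : AlmostDisjoint (L.comp P) (L.comp Q) := by
  simp only [AlmostDisjoint, image_comp, ← L.homeo.image_interior]
  exact (Set.disjoint_image_iff L.homeo.injective).2 h

theorem MeetsLowerFace.comp {L P : LittleCube 2} (hL : L.MeetsLowerFace)
    (hP : P.MeetsLowerFace) : (L.comp P).MeetsLowerFace := by
  simp only [MeetsLowerFace, LittleCube.comp] at *
  rw [app_comp, hP, hL]

theorem comp_assoc {n : ℕ} (L P Q : LittleCube n) : (L.comp P).comp Q = L.comp (P.comp Q) := by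
  funext j
  apply LittleInterval.ext <;> simp only [LittleCube.comp, LittleInterval.comp] <;> ring

theorem one_comp {n : ℕ} (L : LittleCube n) : (one n).comp L = L := by
  funext j
  apply LittleInterval.ext <;>
    simp [LittleCube.comp, LittleInterval.comp, one, LittleInterval.one]

theorem comp_one {n : ℕ} (L : LittleCube n) : L.comp (one n) = L := by
  funext j
  apply LittleInterval.ext <;>
    simp [LittleCube.comp, LittleInterval.comp, one, LittleInterval.one]

theorem _root_.SCLinks.LittleInterval.continuous_comp :
    Continuous (fun p : LittleInterval × LittleInterval => p.1.comp p.2) := by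
  have hab : Continuous (fun l : LittleInterval => (l.a, l.b)) := continuous_induced_dom
  have ha : Continuous (fun l : LittleInterval => l.a) := continuous_fst.comp hab
  have hb : Continuous (fun l : LittleInterval => l.b) := continuous_snd.comp hab
  refine continuous_induced_rng.2 ?_
  show Continuous (fun p : LittleInterval × LittleInterval =>
    (p.1.a * p.2.a, p.1.a * p.2.b + p.1.b))
  fun_prop

theorem continuous_comp {n : ℕ} :
    Continuous (fun p : LittleCube n × LittleCube n => p.1.comp p.2) := by
  refine continuous_pi fun j => ?_
  have h1 : Continuous (fun p : LittleCube n × LittleCube n => p.1 j) := by fun_prop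
  have h2 : Continuous (fun p : LittleCube n × LittleCube n => p.2 j) := by fun_prop
  exact LittleInterval.continuous_comp.comp (h1.prodMk h2)

end LittleCube

/-! ## The Swiss-Cheese operad for links -/

inductive Color
  | o
  | up
  | down
  | updown
  deriving DecidableEq

open LittleCube

/-- The conditions that a configuration `L` of overlapping little squares has to satisfy to be an
operation with inputs `t` and output `s`. -/
def IsSCL {n : ℕ} (t : Fin n → Color) (s : Color) (L : Fin n → LittleCube 2) : Prop :=
  match s with
  | .o => (∀ i, t i = .o → (L i).MeetsLowerFace ∧ ∀ j, j ≠ i → AlmostDisjoint (L i) (L j)) ∧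
      ∀ c, c ≠ .o → ∀ i j, t i = c → t j = c → i ≠ j → AlmostDisjoint (L i) (L j)
  | s => (∀ i, t i = s) ∧ ∀ i j, i ≠ j → AlmostDisjoint (L i) (L j)

/-- The space `SCL(t; s)`, a subspace of the space of overlapping little squares. -/
abbrev SCLOp {n : ℕ} (t : Fin n → Color) (s : Color) : Type :=
  {L : Fin n → LittleCube 2 // IsSCL t s L}

theorem isSCL_act {n : ℕ} {t : Fin n → Color} {s : Color} (σ : Equiv.Perm (Fin n))
    {L : Fin n → LittleCube 2} (h : IsSCL t s L) : IsSCL (t ∘ σ) s (L ∘ σ) := by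
  have key : ∀ i j, i ≠ j → σ i ≠ σ j := fun i j hij => σ.injective.ne hij
  cases s with
  | o =>
    exact ⟨fun i hi => ⟨(h.1 _ hi).1, fun j hj => (h.1 _ hi).2 _ (key _ _ hj)⟩,
      fun c hc i j hi hj hij => h.2 c hc _ _ hi hj (key _ _ hij)⟩
  | up => exact ⟨fun i => h.1 _, fun i j hij => h.2 _ _ (key _ _ hij)⟩
  | down => exact ⟨fun i => h.1 _, fun i j hij => h.2 _ _ (key _ _ hij)⟩
  | updown => exact ⟨fun i => h.1 _, fun i j hij => h.2 _ _ (key _ _ hij)⟩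

theorem isSCL_unit (s : Color) : IsSCL (fun _ : Fin 1 => s) s (fun _ => LittleCube.one 2) := by
  have key : ∀ i j : Fin 1, i ≠ j → False := fun i j h => h (Subsingleton.elim i j)
  cases s with
  | o =>
    exact ⟨fun i _ => ⟨by simp [MeetsLowerFace, LittleCube.one, LittleInterval.one,
      LittleInterval.app], fun j hj => (key _ _ hj).elim⟩,
      fun c hc i j hi hj hij => (key _ _ hij).elim⟩
  | up => exact ⟨fun i => rfl, fun i j hij => (key _ _ hij).elim⟩
  | down => exact ⟨fun i => rfl, fun i j hij => (key _ _ hij).elim⟩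
  | updown => exact ⟨fun i => rfl, fun i j hij => (key _ _ hij).elim⟩

/-- The partial composition of configurations of overlapping little cubes. -/
def compConfig {n m : ℕ} (L : Fin n → LittleCube 2) (i : Fin n) (P : Fin m → LittleCube 2) :
    Fin (n + m - 1) → LittleCube 2 :=
  insertAt L i (fun r => (L i).comp (P r))

theorem isSCL_comp_closed {n m : ℕ} {t : Fin n → Color} {u : Fin m → Color} (i : Fin n)
    {L : Fin n → LittleCube 2} {P : Fin m → LittleCube 2} {c : Color}
    (hL : (∀ i, t i = c) ∧ ∀ i j, i ≠ j → AlmostDisjoint (L i) (L j))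
    (hP : (∀ i, u i = c) ∧ ∀ i j, i ≠ j → AlmostDisjoint (P i) (P j)) :
    (∀ k, insertAt t i u k = c) ∧
      ∀ k k', k ≠ k' → AlmostDisjoint (compConfig L i P k) (compConfig L i P k') := by
  constructor
  · intro k
    obtain ⟨z, rfl⟩ := (slot i m).surjective k
    rw [insertAt_slot]
    rcases z with z | z
    · exact hL.1 _
    · exact hP.1 _
  · intro k k' hk
    obtain ⟨z, rfl⟩ := (slot i m).surjective k
    obtain ⟨z', rfl⟩ := (slot i m).surjective k'
    have hz : z ≠ z' := fun h => hk (congrArg _ h)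
    simp only [compConfig, insertAt_slot]
    rcases z with z | z <;> rcases z' with z' | z'
    · exact hL.2 _ _ (fun h => hz (congrArg _ (Subtype.ext h)))
    · exact (hL.2 _ _ z.2).comp_right _
    · exact ((hL.2 _ _ z'.2).comp_right _).symm
    · exact (hP.2 _ _ (fun h => hz (congrArg _ h))).comp_left _

theorem isSCL_comp_open {n m : ℕ} {t : Fin n → Color} {u : Fin m → Color} (i : Fin n)
    {L : Fin n → LittleCube 2} {P : Fin m → LittleCube 2}
    (hL : IsSCL t .o L) (hP : IsSCL u (t i) P) : IsSCL (insertAt t i u) .o (compConfig L i P) := by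
  have hmono : t i ≠ .o → (∀ r, u r = t i) ∧ ∀ r r', r ≠ r' → AlmostDisjoint (P r) (P r') := by
    revert hP
    cases t i <;> intro hP h
    · exact (h rfl).elim
    all_goals exact hP
  have hopen : t i = .o → IsSCL u .o P := fun h => h ▸ hP
  -- two squares of which one is open, or which have the same colour, are almost disjoint
  have hLL : ∀ j k, j ≠ k → (t j = .o ∨ t j = t k) → AlmostDisjoint (L j) (L k) := by
    intro j k hjk h
    by_cases hj : t j = .o
    · exact (hL.1 j hj).2 k hjk.symm
    · rcases h with h | h
      · exact (hj h).elim
      · exact hL.2 _ hj j k rfl h.symm hjk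
  have hPP : ∀ j k, j ≠ k → (u j = .o ∨ u j = u k) → AlmostDisjoint (P j) (P k) := by
    intro j k hjk h
    by_cases hi : t i = .o
    · have hP' := hopen hi
      by_cases hj : u j = .o
      · exact (hP'.1 j hj).2 k hjk.symm
      · rcases h with h | h
        · exact (hj h).elim
        · exact hP'.2 _ hj j k rfl h.symm hjk
    · exact (hmono hi).2 j k hjk
  have hLP : ∀ j r, j ≠ i → (t j = .o ∨ u r = .o ∨ t j = u r) → AlmostDisjoint (L j) (L i) := by
    intro j r hj h
    by_cases hi : t i = .o
    · exact ((hL.1 i hi).2 j hj).symm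
    · have hr := (hmono hi).1 r
      rcases h with h | h | h
      · exact hLL j i hj (Or.inl h)
      · exact (hi (hr.symm.trans h)).elim
      · exact hLL j i hj (Or.inr (h.trans hr))
  have main : ∀ z z', z ≠ z' →
      (insertAt t i u (slot i m z) = .o ∨
        insertAt t i u (slot i m z) = insertAt t i u (slot i m z')) →
      AlmostDisjoint (compConfig L i P (slot i m z)) (compConfig L i P (slot i m z')) := by
    intro z z' hz h
    simp only [compConfig, insertAt_slot] at h ⊢
    rcases z with z | z <;> rcases z' with z' | z'
    · exact hLL _ _ (fun h => hz (congrArg _ (Subtype.ext h))) h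
    · refine (hLP _ z' z.2 ?_).comp_right _
      rcases h with h | h
      · exact Or.inl h
      · exact Or.inr (Or.inr h)
    · refine ((hLP _ z z'.2 ?_).comp_right _).symm
      rcases h with h | h
      · exact Or.inr (Or.inl h)
      · exact Or.inr (Or.inr h.symm)
    · exact (hPP _ _ (fun h => hz (congrArg _ h)) h).comp_left _
  refine ⟨fun k hk => ⟨?_, fun k' hk' => ?_⟩, fun c _ k k' hk hk' hne => ?_⟩
  · obtain ⟨z, rfl⟩ := (slot i m).surjective k
    simp only [compConfig, insertAt_slot] at hk ⊢
    rcases z with z | z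
    · exact (hL.1 _ hk).1
    · by_cases hi : t i = .o
      · exact (hL.1 i hi).1.comp ((hopen hi).1 z hk).1
      · exact (hi (((hmono hi).1 z).symm.trans hk)).elim
  · obtain ⟨z, rfl⟩ := (slot i m).surjective k
    obtain ⟨z', rfl⟩ := (slot i m).surjective k'
    exact main z z' (fun h => hk' (congrArg _ h.symm)) (Or.inl hk)
  · obtain ⟨z, rfl⟩ := (slot i m).surjective k
    obtain ⟨z', rfl⟩ := (slot i m).surjective k'
    exact main z z' (fun h => hne (congrArg _ h)) (Or.inr (hk.trans hk'.symm))

theorem isSCL_comp {n m : ℕ} {t : Fin n → Color} {u : Fin m → Color} {s : Color} (i : Fin n)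
    {L : Fin n → LittleCube 2} {P : Fin m → LittleCube 2}
    (hL : IsSCL t s L) (hP : IsSCL u (t i) P) : IsSCL (insertAt t i u) s (compConfig L i P) := by
  cases s with
  | o => exact isSCL_comp_open i hL hP
  | up => exact isSCL_comp_closed i hL (by rw [hL.1 i] at hP; exact hP)
  | down => exact isSCL_comp_closed i hL (by rw [hL.1 i] at hP; exact hP)
  | updown => exact isSCL_comp_closed i hL (by rw [hL.1 i] at hP; exact hP)

theorem SCLOp.heq {n n' : ℕ} (h : n = n') {t : Fin n → Color} {t' : Fin n' → Color} {s : Color}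
    (ht : ∀ k, t k = t' (Fin.cast h k)) (a : SCLOp t s) (b : SCLOp t' s)
    (hab : ∀ k, a.1 k = b.1 (Fin.cast h k)) : HEq a b := by
  subst h
  obtain rfl : t = t' := funext ht
  exact heq_of_eq (Subtype.ext (funext hab))

theorem SCLOp.val_eq {n : ℕ} {t : Fin n → Color} {s s' : Color} (h : s = s')
    {a : SCLOp t s} {b : SCLOp t s'} (hab : HEq a b) : a.1 = b.1 := by
  subst h
  rw [eq_of_heq hab]

theorem insertAt_map {α β : Type*} {n m : ℕ} (f : α → β) (t : Fin n → α) (i : Fin n)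
    (u : Fin m → α) (k : Fin (n + m - 1)) :
    f (insertAt t i u k) = insertAt (fun j => f (t j)) i (fun r => f (u r)) k := by
  simp only [insertAt]
  rcases (slot i m).symm k with z | z <;> rfl

/-- The Swiss-Cheese operad for links. -/
def SCL : ColoredOperad Color where
  Op t s := SCLOp t s
  top _ _ := inferInstance
  act σ L := ⟨L.1 ∘ σ, isSCL_act σ L.2⟩
  unit s := ⟨fun _ => LittleCube.one 2, isSCL_unit s⟩
  comp i L P := ⟨compConfig L.1 i P.1, isSCL_comp i L.2 P.2⟩
  continuous_act σ := by
    refine Continuous.subtype_mk ?_ _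
    exact continuous_pi fun k => (continuous_apply (σ k)).comp continuous_subtype_val
  continuous_comp {n m t u s} i := by
    refine Continuous.subtype_mk ?_ _
    refine continuous_pi fun k => ?_
    obtain ⟨z, rfl⟩ := (slot i m).surjective k
    simp only [compConfig, insertAt_slot]
    rcases z with z | z
    · exact (continuous_apply z.1).comp (continuous_subtype_val.comp continuous_fst)
    · have h1 : Continuous (fun p : SCLOp t s × SCLOp u (t i) => p.1.1 i) :=
        (continuous_apply i).comp (continuous_subtype_val.comp continuous_fst)
      have h2 : Continuous (fun p : SCLOp t s × SCLOp u (t i) => p.2.1 z) :=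
        (continuous_apply z).comp (continuous_subtype_val.comp continuous_snd)
      exact LittleCube.continuous_comp.comp (h1.prodMk h2)
  act_one _ := rfl
  act_act _ _ _ := rfl
  unit_comp {n t s} a := by
    refine SCLOp.heq (by omega) (fun k => insertAt_unit_left _ _ (by omega) k) _ _ fun k => ?_
    refine (insertAt_unit_left _ _ (by omega) k).trans ?_
    exact LittleCube.one_comp _
  comp_unit {n t s} a i := by
    refine SCLOp.heq rfl (fun k => insertAt_unit_right t i (fun _ => t i) rfl k) _ _ fun k => ?_
    exact insertAt_unit_right a.1 i _ (LittleCube.comp_one _) k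
  comp_seq {n m l t u v s} i j a b c c' hc := by
    have hlen : n + m - 1 + l - 1 = n + (m + l - 1) - 1 := by
      have := i.2
      have := j.2
      omega
    have hc' : c'.1 = c.1 := SCLOp.val_eq (insertAt_slot _ _ _ _) hc
    refine SCLOp.heq hlen (fun k => insertAt_seq _ _ _ _ _ hlen k) _ _ fun k => ?_
    simp only [compConfig, hc', insertAt_slot, Sum.elim_inr]
    refine (insertAt_seq _ _ _ _ _ hlen k).trans ?_
    congr 1
    funext r
    simp only [insertAt_map (fun x => (a.1 i).comp x), LittleCube.comp_assoc]
  comp_par {n m l t u v s} i k hik a b c b' c' hb hc := by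
    have hlen : n + m - 1 + l - 1 = n + l - 1 + m - 1 := by
      have := i.2
      have := k.2
      have := Fin.val_ne_of_ne hik
      omega
    have hc' : c'.1 = c.1 := SCLOp.val_eq (insertAt_slot _ _ _ _) hc
    have hb' : b'.1 = b.1 := SCLOp.val_eq (insertAt_slot _ _ _ _) hb
    refine SCLOp.heq hlen (fun p => insertAt_par _ _ _ hik _ _ hlen p) _ _ fun p => ?_
    simp only [compConfig, hc', hb', insertAt_slot, Sum.elim_inl]
    exact insertAt_par _ _ _ hik _ _ hlen p
  comp_act {n m t u s} σ τ i a b := by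
    refine SCLOp.heq rfl (fun k => insertAt_blockPerm _ _ σ i τ k) _ _ fun k => ?_
    exact insertAt_blockPerm a.1 (fun r => (a.1 (σ i)).comp (b.1 r)) σ i τ k

/-! ## Framed long knots and framed string 2-links -/

abbrev Plane := EuclideanSpace ℝ (Fin 2)

/-- The closed unit disc `D²`. -/
abbrev Disc := Metric.closedBall (0 : Plane) 1

/-- The cylinder `ℝ × D²`. -/
abbrev Cyl := ℝ × Disc

/-- The cylinder as a subset of `ℝ × ℝ²`. -/
def cylSet : Set (ℝ × Plane) := Set.univ ×ˢ Metric.closedBall (0 : Plane) 1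

def toAmbient (p : Cyl) : ℝ × Plane := (p.1, p.2.1)

open Classical in
/-- A self-map of the cylinder, as a map between ambient spaces; only its values on `cylSet` matter,
and it is given the value `0` elsewhere. -/
def ambient (f : Cyl → Cyl) (p : ℝ × Plane) : ℝ × Plane :=
  if h : p.2 ∈ Metric.closedBall (0 : Plane) 1 then toAmbient (f (p.1, ⟨p.2, h⟩)) else 0

/-- Smooth immersions of the cylinder in itself. Smoothness is `C^∞` on the closed subset `cylSet`,
boundary included, and the derivative is injective at every point, boundary points included. -/
structure IsSmoothImmersion (f : Cyl → Cyl) : Prop where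
  smooth : ContDiffOn ℝ ∞ (ambient f) cylSet
  injective_fderiv : ∀ p : Cyl,
    Function.Injective (fderivWithin ℝ (ambient f) cylSet (toAmbient p))

/-- The `n`-th derivative of a self-map of the cylinder. The target carries the uniformity of uniform
convergence on compact subsets. -/
def jet (n : ℕ) (f : Cyl → Cyl) :
    UniformOnFun Cyl (ContinuousMultilinearMap ℝ (fun _ : Fin n => ℝ × Plane) (ℝ × Plane))
      {K | IsCompact K} :=
  UniformOnFun.ofFun {K | IsCompact K}
    (fun p => iteratedFDerivWithin ℝ n (ambient f) cylSet (toAmbient p))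

/-- The space `EC(1, D²)` of framed long knots: smooth embeddings `ℝ × D² → ℝ × D²` that restrict to
the identity outside of `J × D²`. -/
@[ext]
structure FramedKnot where
  toFun : Cyl → Cyl
  isEmbedding : Topology.IsEmbedding toFun
  immersion : IsSmoothImmersion toFun
  eq_id : ∀ p : Cyl, p.1 ∉ Set.Icc (-1 : ℝ) 1 → toFun p = p

/-- The `C^∞`-topology: uniform convergence of all derivatives on compact subsets. -/
instance : TopologicalSpace FramedKnot :=
  ⨅ n : ℕ, TopologicalSpace.induced (fun f => jet n f.toFun) inferInstance

/-- The disc of radius `1/8` centred at `(0, c)`, parametrized by `D²`. -/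
def shrinkDisc (c : ℝ) (hc : |c| ≤ 7 / 8) (x : Disc) : Disc :=
  ⟨(1 / 8 : ℝ) • x.1 + !₂[0, c], by
    have hx : ‖x.1‖ ≤ 1 := mem_closedBall_zero_iff.1 x.2
    have h1 : ‖(1 / 8 : ℝ) • x.1‖ ≤ 1 / 8 := by
      rw [norm_smul, Real.norm_of_nonneg (by norm_num)]; linarith
    have h2 : ‖(!₂[0, c] : Plane)‖ = |c| := by
      simp [EuclideanSpace.norm_eq, Real.sqrt_sq_eq_abs]
    have h3 := norm_add_le ((1 / 8 : ℝ) • x.1) (!₂[0, c] : Plane)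
    rw [mem_closedBall_zero_iff]
    linarith⟩

/-- The standard embedding `id × ι` of two copies of the cylinder. The first summand is the upper
strand and the second one is the lower strand. -/
def stdLink : Cyl ⊕ Cyl → Cyl :=
  Sum.elim (Prod.map id (shrinkDisc (1 / 2) (by rw [abs_of_pos] <;> norm_num)))
    (Prod.map id (shrinkDisc (-(1 / 2)) (by rw [abs_neg, abs_of_pos] <;> norm_num)))

/-- The coordinate in `ℝ` of a point of the two cylinders. -/
def axial : Cyl ⊕ Cyl → ℝ := Sum.elim Prod.fst Prod.fst

/-- The space `EC_ι(1, D²)` of framed string 2-links: smooth embeddings of two cylinders in the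
cylinder that restrict to the standard embedding outside of `J × D²` and that map the interior of
`(J × D²) ⨿ (J × D²)` in the interior `(-1, 1) × D²` of `J × D²` (interiors of subsets of the
cylinders). -/
@[ext]
structure FramedLink where
  toFun : Cyl ⊕ Cyl → Cyl
  isEmbedding : Topology.IsEmbedding toFun
  immersion_up : IsSmoothImmersion (fun p => toFun (Sum.inl p))
  immersion_down : IsSmoothImmersion (fun p => toFun (Sum.inr p))
  eq_std : ∀ p, axial p ∉ Set.Icc (-1 : ℝ) 1 → toFun p = stdLink p
  mapsTo_interior : ∀ p, axial p ∈ Set.Ioo (-1 : ℝ) 1 → (toFun p).1 ∈ Set.Ioo (-1 : ℝ) 1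

/-- The `C^∞`-topology: uniform convergence of all derivatives on compact subsets. -/
instance : TopologicalSpace FramedLink :=
  ⨅ n : ℕ, TopologicalSpace.induced
    (fun f => (jet n (fun p => f.toFun (Sum.inl p)), jet n (fun p => f.toFun (Sum.inr p))))
    inferInstance

/-- The quadruplet `X = (EC_ι(1, D²), EC(1, D²), EC(1, D²), EC(1, D²))`. -/
abbrev linkSpaces : Color → Type
  | .o => FramedLink
  | .up => FramedKnot
  | .down => FramedKnot
  | .updown => FramedKnot

instance : ∀ s, TopologicalSpace (linkSpaces s)
  | .o => inferInstanceAs (TopologicalSpace FramedLink)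
  | .up => inferInstanceAs (TopologicalSpace FramedKnot)
  | .down => inferInstanceAs (TopologicalSpace FramedKnot)
  | .updown => inferInstanceAs (TopologicalSpace FramedKnot)

/-! ## The operations -/

/-- The action `(l, f) ↦ (l × id) ∘ f ∘ (l⁻¹ × id)` on self-maps of the cylinder. -/
def knotAct (l : LittleInterval) (f : Cyl → Cyl) : Cyl → Cyl :=
  Prod.map l.app id ∘ f ∘ Prod.map l.inv id

/-- The action `(l, f) ↦ (l × id) ∘ f ∘ (l⁻¹ × id)^{⨿ 2}` on maps from two cylinders. -/
def linkAct (l : LittleInterval) (f : Cyl ⊕ Cyl → Cyl) : Cyl ⊕ Cyl → Cyl :=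
  Prod.map l.app id ∘ f ∘ Sum.map (Prod.map l.inv id) (Prod.map l.inv id)

/-- The relation `Lⁱ_t < Lʲ_t` and the interiors of the images of `Lⁱ_π` and `Lʲ_π` intersect. -/
def Below {k : ℕ} (L : Fin k → LittleCube 2) (i j : Fin k) : Prop :=
  (L i).height < (L j).height ∧
    (interior (L i).proj.image ∩ interior (L j).proj.image).Nonempty

/-- `σ` orders `L`: it lists the squares compatibly with the partial order generated by `Below`. -/
def Orders {k : ℕ} (L : Fin k → LittleCube 2) (σ : Equiv.Perm (Fin k)) : Prop :=
  ∀ i j, Relation.TransGen (Below L) (σ i) (σ j) → i < j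

/-- `σ` orders `L` with respect to the opposite partial order. -/
def ReverseOrders {k : ℕ} (L : Fin k → LittleCube 2) (σ : Equiv.Perm (Fin k)) : Prop :=
  ∀ i j, Relation.TransGen (Below L) (σ i) (σ j) → j < i

/-- The composite `(L^{σ(1)}_π f_{σ(1)}) ∘ ⋯ ∘ (L^{σ(k)}_π f_{σ(k)})`; the identity if `k = 0`. -/
def kappa {k : ℕ} (L : Fin k → LittleCube 2) (σ : Equiv.Perm (Fin k)) (f : Fin k → FramedKnot) :
    Cyl → Cyl :=
  (List.ofFn fun i => knotAct (L (σ i)).proj (f (σ i)).toFun).foldr (fun g h => g ∘ h) id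

open Classical in
/-- The concatenation of the links `fᵢ` according to the little intervals `lᵢ`: it is `lᵢ fᵢ` over
`lᵢ(J)`, and the standard embedding elsewhere. -/
def lambda {k : ℕ} (l : Fin k → LittleInterval) (f : Fin k → FramedLink) : Cyl ⊕ Cyl → Cyl :=
  fun p => if h : ∃ i, axial p ∈ (l i).image then linkAct (l h.choose) (f h.choose).toFun p
    else stdLink p

/-- The number of times that the colour `s` appears in `t`. -/
def colorCount {n : ℕ} (t : Fin n → Color) (s : Color) : ℕ := Fintype.card {i // t i = s}

/-- Colour sorting functions for `t`. -/
structure ColorSorting {n : ℕ} (t : Fin n → Color) where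
  fn : ∀ s, Fin (colorCount t s) → Fin n
  injective : ∀ s, Function.Injective (fn s)
  color : ∀ s i, t (fn s i) = s
  cover : ∀ j, ∃ s i, fn s i = j

namespace ColorSorting

variable {n : ℕ} {t : Fin n → Color}

/-- The squares of colour `s` of a configuration. -/
def cubes (α : ColorSorting t) (s : Color) (L : Fin n → LittleCube 2) :
    Fin (colorCount t s) → LittleCube 2 := fun i => L (α.fn s i)

/-- The entries of colour `s` of a tuple in `X^t`. -/
def entries (α : ColorSorting t) (s : Color) (f : ∀ i, linkSpaces (t i)) :
    Fin (colorCount t s) → linkSpaces s :=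
  fun i => cast (congrArg linkSpaces (α.color s i)) (f (α.fn s i))

end ColorSorting

/-- The structure maps of `A` are the operations `μ`, for every choice of ordering permutations and of
colour sorting functions. -/
structure IsMu (A : OperadAlgebra SCL linkSpaces) : Prop where
  /-- Budney's action on the colour `up` -/
  up : ∀ {k : ℕ} (L : SCLOp (fun _ : Fin k => Color.up) .up) (f : Fin k → FramedKnot)
    (σ : Equiv.Perm (Fin k)), Orders L.1 σ →
    FramedKnot.toFun (A.map (t := fun _ : Fin k => Color.up) (s := .up) L f) = kappa L.1 σ f
  /-- Budney's action on the colour `down` -/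
  down : ∀ {k : ℕ} (L : SCLOp (fun _ : Fin k => Color.down) .down) (f : Fin k → FramedKnot)
    (σ : Equiv.Perm (Fin k)), Orders L.1 σ →
    FramedKnot.toFun (A.map (t := fun _ : Fin k => Color.down) (s := .down) L f) = kappa L.1 σ f
  /-- Budney's reverse action on the colour `updown` -/
  updown : ∀ {k : ℕ} (L : SCLOp (fun _ : Fin k => Color.updown) .updown) (f : Fin k → FramedKnot)
    (σ : Equiv.Perm (Fin k)), ReverseOrders L.1 σ →
    FramedKnot.toFun (A.map (t := fun _ : Fin k => Color.updown) (s := .updown) L f) =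
      kappa L.1 σ f
  /-- Burke and Koytcheff's action, through the projection `L ↦ L_π`, on the colour `o` -/
  open_mono : ∀ {k : ℕ} (L : SCLOp (fun _ : Fin k => Color.o) .o) (f : Fin k → FramedLink),
    FramedLink.toFun (A.map (t := fun _ : Fin k => Color.o) (s := .o) L f) =
      lambda (fun i => (L.1 i).proj) f
  /-- mixed operations -/
  mixed : ∀ {n : ℕ} {t : Fin n → Color} (L : SCLOp t .o) (f : ∀ i, linkSpaces (t i))
    (α : ColorSorting t)
    (σu : Equiv.Perm (Fin (colorCount t .up))) (σd : Equiv.Perm (Fin (colorCount t .down)))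
    (σud : Equiv.Perm (Fin (colorCount t .updown))),
    Orders (α.cubes .up L.1) σu → Orders (α.cubes .down L.1) σd →
    ReverseOrders (α.cubes .updown L.1) σud →
    FramedLink.toFun (A.map (t := t) (s := .o) L f) =
      kappa (α.cubes .updown L.1) σud (α.entries .updown f) ∘
        lambda (fun i => (α.cubes .o L.1 i).proj) (α.entries .o f) ∘
        Sum.map (kappa (α.cubes .up L.1) σu (α.entries .up f))
          (kappa (α.cubes .down L.1) σd (α.entries .down f))

end SCLinks

end

noncomputable section

namespace SCLinks

/-! ## Smooth families of self-maps of the cylinder -/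

/-! Framed long knots form a topological monoid under composition, and a little interval `l` acts on
it by an endomorphism `FramedKnot.conj`, continuous in both arguments. A conjugated knot is the
identity away from the open interval `l.core` and preserves the part of the cylinder over it, so
conjugates over disjoint intervals commute (`FramedKnot.commute_conj`). Almost disjoint squares of
which neither lies under the other have disjoint projections. Hence all admissible listings of the
same squares give the same product (`List.prod_map_eq_of_perm`), and Budney's action is a function
`kap` of a multiset of labelled squares. Concatenation is likewise a function `lam` of a multiset.
Working with multisets settles the independence of orderings and listings, as well as the symmetric
actions.

For composition within one closed colour, a block of inner squares can replace the outer square in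
an admissible listing without spoiling it, and conjugation is multiplicative
(`kap_add_singleton_kap`). For insertion in an open square `L`, which meets the lower face, no
square almost disjoint from `L` lies under a square inside `L`. The inner squares can therefore be
listed first for `kap false` and last for `kap true`. These are the positions produced by nesting:
in k ∘ (k' ∘ g ∘ (u ⨿ d)) ∘ (u' ⨿ d') the outer knot k stands to the left of k', while the outer
knots u', d' stand to the right of u, d. This is the role of the reverse action on `updown`. Finally
`lam_add_singleton_sandwich` pulls the inner knots out of a concatenation, the other strips being
disjoint from that of `L`; the pieces meet in `mu_open_open`.

On the analytic side, the C^∞-topology is handled by joint continuity of all jets in parameter and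
point (`SmoothFamily`), which the Faà di Bruno formula shows to be stable under composition. A
concatenation equals the standard link plus the sum of the differences lᵢfᵢ - std, so smoothness and
continuity in parameters need no matching of derivatives at endpoints. For `kap`, the configuration
space is covered by finitely many closed sets, one for each permutation, on each of which `kap` is a
fixed product (`continuous_kap`). Uniqueness holds because ordering permutations and colour sortings
always exist. -/

theorem uniqueDiffOn_disc : UniqueDiffOn ℝ (Metric.closedBall (0 : Plane) 1) :=
  uniqueDiffOn_convex (convex_closedBall _ _)
    ⟨0, Metric.ball_subset_interior_closedBall (by simp)⟩

theorem uniqueDiffOn_cylSet : UniqueDiffOn ℝ cylSet :=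
  uniqueDiffOn_univ.prod uniqueDiffOn_disc

theorem toAmbient_mem (p : Cyl) : toAmbient p ∈ cylSet := ⟨trivial, p.2.2⟩

theorem exists_toAmbient {q : ℝ × Plane} (hq : q ∈ cylSet) : ∃ p : Cyl, toAmbient p = q :=
  ⟨(q.1, ⟨q.2, hq.2⟩), rfl⟩

theorem continuous_toAmbient : Continuous toAmbient := by
  unfold toAmbient; fun_prop

theorem isEmbedding_toAmbient : Topology.IsEmbedding toAmbient :=
  Topology.IsEmbedding.id.prodMap Topology.IsEmbedding.subtypeVal

@[simp]
theorem ambient_toAmbient (f : Cyl → Cyl) (p : Cyl) :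
    ambient f (toAmbient p) = toAmbient (f p) := by
  have h : (toAmbient p).2 ∈ Metric.closedBall (0 : Plane) 1 := p.2.2
  simp only [ambient, h, dif_pos]
  rfl

theorem ambient_mapsTo (f : Cyl → Cyl) : Set.MapsTo (ambient f) cylSet cylSet := by
  intro q hq
  obtain ⟨p, rfl⟩ := exists_toAmbient hq
  rw [ambient_toAmbient]
  exact toAmbient_mem _

theorem eqOn_ambient {f : Cyl → Cyl} {g : ℝ × Plane → ℝ × Plane}
    (h : ∀ p, toAmbient (f p) = g (toAmbient p)) : Set.EqOn (ambient f) g cylSet := by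
  intro q hq
  obtain ⟨p, rfl⟩ := exists_toAmbient hq
  rw [ambient_toAmbient, h]

theorem ambient_comp (g f : Cyl → Cyl) :
    Set.EqOn (ambient (g ∘ f)) (ambient g ∘ ambient f) cylSet :=
  eqOn_ambient fun p => by simp

theorem contDiffOn_comp {g f : Cyl → Cyl} (hg : ContDiffOn ℝ ∞ (ambient g) cylSet)
    (hf : ContDiffOn ℝ ∞ (ambient f) cylSet) : ContDiffOn ℝ ∞ (ambient (g ∘ f)) cylSet :=
  (hg.comp hf (ambient_mapsTo f)).congr (ambient_comp g f)

theorem continuous_of_contDiffOn {f : Cyl → Cyl} (hf : ContDiffOn ℝ ∞ (ambient f) cylSet) :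
    Continuous f := by
  rw [isEmbedding_toAmbient.continuous_iff]
  have := hf.continuousOn.comp_continuous continuous_toAmbient toAmbient_mem
  simpa [Function.comp_def] using this

/-- A family of smooth self-maps of the cylinder all of whose derivatives are jointly continuous in
the parameter and the point. -/
structure SmoothFamily {X : Type*} [TopologicalSpace X] (F : X → Cyl → Cyl) : Prop where
  smooth : ∀ x, ContDiffOn ℝ ∞ (ambient (F x)) cylSet
  continuous_jet : ∀ n : ℕ, Continuous (fun z : X × Cyl =>
    iteratedFDerivWithin ℝ n (ambient (F z.1)) cylSet (toAmbient z.2))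

theorem continuous_iteratedFDerivWithin {f : Cyl → Cyl} (hf : ContDiffOn ℝ ∞ (ambient f) cylSet)
    (n : ℕ) : Continuous (fun p : Cyl =>
      iteratedFDerivWithin ℝ n (ambient f) cylSet (toAmbient p)) :=
  (hf.continuousOn_iteratedFDerivWithin (by exact_mod_cast le_top)
    uniqueDiffOn_cylSet).comp_continuous continuous_toAmbient toAmbient_mem

/-- This is the exponential law for the compact-open topology on `C(Cyl, _)`; local compactness of
the cylinder is what makes evaluation jointly continuous. It replaces uniform convergence on compact
sets by plain joint continuity everywhere below. -/
theorem continuous_jet_iff {X : Type*} [TopologicalSpace X] {F : X → Cyl → Cyl}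
    (hF : ∀ x, ContDiffOn ℝ ∞ (ambient (F x)) cylSet) (n : ℕ) :
    Continuous (fun x => jet n (F x)) ↔ Continuous (fun z : X × Cyl =>
      iteratedFDerivWithin ℝ n (ambient (F z.1)) cylSet (toAmbient z.2)) := by
  let J : X → C(Cyl, ContinuousMultilinearMap ℝ (fun _ : Fin n => ℝ × Plane) (ℝ × Plane)) :=
    fun x => ⟨_, continuous_iteratedFDerivWithin (hF x) n⟩
  have h1 : (fun x => jet n (F x)) = ContinuousMap.toUniformOnFunIsCompact ∘ J := rfl
  rw [h1, ← ContinuousMap.isUniformEmbedding_toUniformOnFunIsCompact.isInducing.continuous_iff]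
  constructor
  · intro h
    have : Continuous (fun z : X × Cyl => J z.1 z.2) := by fun_prop
    exact this
  · intro h
    exact ContinuousMap.continuous_of_continuous_uncurry J h

namespace SmoothFamily

variable {X Y : Type*} [TopologicalSpace X] [TopologicalSpace Y]

theorem of_continuous {F : X → Cyl → Cyl}
    (hF : ∀ x, ContDiffOn ℝ ∞ (ambient (F x)) cylSet)
    (h : ∀ n, Continuous (fun x => jet n (F x))) : SmoothFamily F :=
  ⟨hF, fun n => (continuous_jet_iff hF n).1 (h n)⟩

theorem continuous {F : X → Cyl → Cyl} (hF : SmoothFamily F) (n : ℕ) :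
    Continuous (fun x => jet n (F x)) :=
  (continuous_jet_iff hF.smooth n).2 (hF.continuous_jet n)

theorem precomp {F : X → Cyl → Cyl} (hF : SmoothFamily F) {φ : Y → X} (hφ : Continuous φ) :
    SmoothFamily (fun y => F (φ y)) :=
  ⟨fun y => hF.smooth _, fun n => (hF.continuous_jet n).comp
    (f := fun z : Y × Cyl => (φ z.1, z.2)) (by fun_prop)⟩

theorem const {f : Cyl → Cyl} (hf : ContDiffOn ℝ ∞ (ambient f) cylSet) :
    SmoothFamily (fun _ : X => f) :=
  ⟨fun _ => hf, fun n => (continuous_iteratedFDerivWithin hf n).comp continuous_snd⟩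

theorem continuous_uncurry {F : X → Cyl → Cyl} (hF : SmoothFamily F) :
    Continuous (fun z : X × Cyl => F z.1 z.2) := by
  rw [isEmbedding_toAmbient.continuous_iff]
  -- The jet of order 0 is the map itself, recovered by evaluation at the empty vector.
  have h := hF.continuous_jet 0
  have h' : Continuous (fun z : X × Cyl =>
      (iteratedFDerivWithin ℝ 0 (ambient (F z.1)) cylSet (toAmbient z.2)) 0) := by
    exact (ContinuousMultilinearMap.apply ℝ (fun _ : Fin 0 => ℝ × Plane) (ℝ × Plane) 0
      ).continuous.comp h
  simpa [Function.comp_def] using h'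

/-- Faà di Bruno's formula: Taylor series compose, and on a set with unique derivatives the Taylor
series of a map is determined by the map. -/
theorem iteratedFDerivWithin_ambient_comp {g f : Cyl → Cyl}
    (hg : ContDiffOn ℝ ∞ (ambient g) cylSet) (hf : ContDiffOn ℝ ∞ (ambient f) cylSet) (n : ℕ)
    (p : Cyl) :
    iteratedFDerivWithin ℝ n (ambient (g ∘ f)) cylSet (toAmbient p) =
      ∑ c : OrderedFinpartition n,
        c.compAlongOrderedFinpartitionL ℝ (ℝ × Plane) (ℝ × Plane) (ℝ × Plane)
          (iteratedFDerivWithin ℝ c.length (ambient g) cylSet (toAmbient (f p)))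
        (fun m => iteratedFDerivWithin ℝ (c.partSize m) (ambient f) cylSet (toAmbient p)) := by
  have h1 := (hg.ftaylorSeriesWithin uniqueDiffOn_cylSet).comp
    (hf.ftaylorSeriesWithin uniqueDiffOn_cylSet) (ambient_mapsTo f)
  have h2 := h1.eq_iteratedFDerivWithin_of_uniqueDiffOn (m := n) (by exact_mod_cast le_top)
    uniqueDiffOn_cylSet (toAmbient_mem p)
  rw [iteratedFDerivWithin_congr (ambient_comp g f) (toAmbient_mem p), ← h2, ambient_toAmbient]
  rfl

theorem comp {G F : X → Cyl → Cyl} (hG : SmoothFamily G) (hF : SmoothFamily F) :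
    SmoothFamily (fun x => G x ∘ F x) := by
  refine ⟨fun x => contDiffOn_comp (hG.smooth x) (hF.smooth x), fun n => ?_⟩
  simp only [iteratedFDerivWithin_ambient_comp (hG.smooth _) (hF.smooth _)]
  refine continuous_finsetSum _ fun c _ => ?_
  have h1 : Continuous (fun z : X × Cyl => iteratedFDerivWithin ℝ c.length (ambient (G z.1)) cylSet
      (toAmbient (F z.1 z.2))) :=
    (hG.continuous_jet c.length).comp (f := fun z : X × Cyl => (z.1, F z.1 z.2))
      (continuous_fst.prodMk hF.continuous_uncurry)
  have h2 : Continuous (fun (z : X × Cyl) (m : Fin c.length) =>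
      iteratedFDerivWithin ℝ (c.partSize m) (ambient (F z.1)) cylSet (toAmbient z.2)) :=
    continuous_pi fun m => hF.continuous_jet _
  exact ((c.compAlongOrderedFinpartitionL ℝ _ _ _).continuous.comp h1).eval h2

/-! ### Linear combinations with varying coefficients -/

theorem iteratedFDerivWithin_sum_smul {ι : Type*} (s : Finset ι) (a : ι → ℝ)
    {A : ι → ℝ × Plane → ℝ × Plane} (hA : ∀ i, ContDiffOn ℝ ∞ (A i) cylSet) (n : ℕ) (p : Cyl) :
    iteratedFDerivWithin ℝ n (fun q => ∑ i ∈ s, a i • A i q) cylSet (toAmbient p) =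
      ∑ i ∈ s, a i • iteratedFDerivWithin ℝ n (A i) cylSet (toAmbient p) := by
  have h : ∀ i, ContDiffWithinAt ℝ n (A i) cylSet (toAmbient p) := fun i =>
    (hA i _ (toAmbient_mem p)).of_le (by exact_mod_cast le_top)
  rw [iteratedFDerivWithin_fun_sum_apply (f := fun i q => a i • A i q) uniqueDiffOn_cylSet
    (toAmbient_mem p) fun i _ => (h i).const_smul (R := ℝ) (a i)]
  refine Finset.sum_congr rfl fun i _ => ?_
  exact iteratedFDerivWithin_const_smul_apply (a := a i) (h i) uniqueDiffOn_cylSet (toAmbient_mem p)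

/-- Linear combinations of smooth families whose coefficients depend continuously on the
parameter. -/
theorem of_sum_smul {ι : Type*} (s : Finset ι) {a : X → ι → ℝ} (ha : ∀ i, Continuous fun x => a x i)
    {A : X → ι → ℝ × Plane → ℝ × Plane} (hA : ∀ x i, ContDiffOn ℝ ∞ (A x i) cylSet)
    (hc : ∀ i, ∀ n : ℕ, Continuous (fun z : X × Cyl =>
      iteratedFDerivWithin ℝ n (A z.1 i) cylSet (toAmbient z.2)))
    {F : X → Cyl → Cyl}
    (hF : ∀ x p, toAmbient (F x p) = ∑ i ∈ s, a x i • A x i (toAmbient p)) : SmoothFamily F := by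
  have h : ∀ x, Set.EqOn (ambient (F x)) (fun q => ∑ i ∈ s, a x i • A x i q) cylSet :=
    fun x => eqOn_ambient (hF x)
  refine ⟨fun x => ContDiffOn.congr ?_ (h x), fun n => ?_⟩
  · exact ContDiffOn.sum fun i _ => (hA x i).const_smul (a x i)
  · simp only [iteratedFDerivWithin_congr (h _) (toAmbient_mem _),
      iteratedFDerivWithin_sum_smul s (a _) (hA _)]
    refine continuous_finsetSum _ fun i _ => ?_
    exact ((ha i).comp continuous_fst).smul (hc i n)

end SmoothFamily

/-- The affine self-map `(x, y) ↦ (a x + b, y)` of the cylinder. -/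
def stretch (c : ℝ × ℝ) : Cyl → Cyl := fun p => (c.1 * p.1 + c.2, p.2)

theorem smoothFamily_stretch : SmoothFamily stretch := by
  -- The stretch is (ax + b, y) = a·(x, 0) + b·(1, 0) + 1·(0, y): fixed maps, with coefficients that
  -- are continuous in the parameter.
  let A : Fin 3 → ℝ × Plane → ℝ × Plane :=
    ![fun q => (q.1, 0), fun _ => (1, 0), fun q => (0, q.2)]
  have hA : ∀ i, ContDiff ℝ ∞ (A i) := by
    intro i
    fin_cases i
    · exact contDiff_fst.prodMk contDiff_const
    · exact contDiff_const
    · exact contDiff_const.prodMk contDiff_snd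
  refine SmoothFamily.of_sum_smul Finset.univ (a := fun c => ![c.1, c.2, 1]) ?_
    (A := fun _ => A) (fun _ i => (hA i).contDiffOn) ?_ ?_
  · intro i
    fin_cases i
    · exact continuous_fst
    · exact continuous_snd
    · exact continuous_const
  · intro i n
    exact (((hA i).contDiffOn.continuousOn_iteratedFDerivWithin (by exact_mod_cast le_top)
      uniqueDiffOn_cylSet).comp_continuous continuous_toAmbient toAmbient_mem).comp continuous_snd
  · intro c p
    simp [Fin.sum_univ_three, A, stretch, toAmbient]

/-! ## Immersions -/

theorem differentiableWithinAt_ambient {f : Cyl → Cyl} (hf : ContDiffOn ℝ ∞ (ambient f) cylSet)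
    (p : Cyl) : DifferentiableWithinAt ℝ (ambient f) cylSet (toAmbient p) :=
  (hf _ (toAmbient_mem p)).differentiableWithinAt (by simp)

theorem IsSmoothImmersion.comp {g f : Cyl → Cyl} (hg : IsSmoothImmersion g)
    (hf : IsSmoothImmersion f) : IsSmoothImmersion (g ∘ f) := by
  refine ⟨contDiffOn_comp hg.smooth hf.smooth, fun p => ?_⟩
  have h1 := differentiableWithinAt_ambient hf.smooth p
  have h2 := differentiableWithinAt_ambient hg.smooth (f p)
  rw [← ambient_toAmbient] at h2
  rw [fderivWithin_congr (ambient_comp g f) (ambient_comp g f (toAmbient_mem p)),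
    fderivWithin_comp _ h2 h1 (ambient_mapsTo f) (uniqueDiffOn_cylSet _ (toAmbient_mem p)),
    ambient_toAmbient]
  exact (hg.injective_fderiv _).comp (hf.injective_fderiv p)

/-- By the chain rule, the derivative of a differentiable left inverse is a left inverse of the
derivative. -/
theorem IsSmoothImmersion.of_leftInverse {f : Cyl → Cyl} (hf : ContDiffOn ℝ ∞ (ambient f) cylSet)
    {h : ℝ × Plane → ℝ × Plane} (hh : Differentiable ℝ h)
    (hl : ∀ p, h (toAmbient (f p)) = toAmbient p) : IsSmoothImmersion f := by
  refine ⟨hf, fun p => ?_⟩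
  have hu := uniqueDiffOn_cylSet _ (toAmbient_mem p)
  have h1 := differentiableWithinAt_ambient hf p
  have h2 : Set.EqOn (h ∘ ambient f) id cylSet := by
    intro q hq
    obtain ⟨p, rfl⟩ := exists_toAmbient hq
    simp [hl]
  have h3 : (fderiv ℝ h (ambient f (toAmbient p))).comp
      (fderivWithin ℝ (ambient f) cylSet (toAmbient p)) = ContinuousLinearMap.id ℝ _ := by
    rw [← fderiv_comp_fderivWithin _ (hh _) h1 hu,
      fderivWithin_congr h2 (h2 (toAmbient_mem p)), fderivWithin_id hu]
  intro v w hvw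
  have := congrArg (fderiv ℝ h (ambient f (toAmbient p))) hvw
  rw [← ContinuousLinearMap.comp_apply, ← ContinuousLinearMap.comp_apply, h3] at this
  exact this

/-- Both derivatives can be computed inside V × D², where derivatives are unique. The set V need not
be open, so endpoints of a closed interval are covered too. -/
theorem fderivWithin_ambient_congr {f g : Cyl → Cyl} (hf : ContDiffOn ℝ ∞ (ambient f) cylSet)
    (hg : ContDiffOn ℝ ∞ (ambient g) cylSet) {V : Set ℝ} (hV : UniqueDiffOn ℝ V)
    (h : ∀ p : Cyl, p.1 ∈ V → f p = g p) {p : Cyl} (hp : p.1 ∈ V) :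
    fderivWithin ℝ (ambient f) cylSet (toAmbient p) =
      fderivWithin ℝ (ambient g) cylSet (toAmbient p) := by
  have hsub : V ×ˢ Metric.closedBall (0 : Plane) 1 ⊆ cylSet :=
    Set.prod_mono (Set.subset_univ _) le_rfl
  have hmem : toAmbient p ∈ V ×ˢ Metric.closedBall (0 : Plane) 1 := ⟨hp, p.2.2⟩
  have hu := (hV.prod uniqueDiffOn_disc) _ hmem
  have he : Set.EqOn (ambient f) (ambient g) (V ×ˢ Metric.closedBall (0 : Plane) 1) := by
    intro q hq
    obtain ⟨p, rfl⟩ := exists_toAmbient (hsub hq)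
    rw [ambient_toAmbient, ambient_toAmbient, h p hq.1]
  rw [← fderivWithin_subset hsub hu (differentiableWithinAt_ambient hf p),
    ← fderivWithin_subset hsub hu (differentiableWithinAt_ambient hg p),
    fderivWithin_congr he (he hmem)]

/-! ## Little intervals -/

namespace LittleInterval

/-- The interior of the image of a little interval. -/
def core (l : LittleInterval) : Set ℝ := Set.Ioo (l.b - l.a) (l.b + l.a)

theorem inv_app (l : LittleInterval) (x : ℝ) : l.inv (l.app x) = x := by
  have := l.pos.ne'
  simp only [app, inv]; field_simp; ring

theorem app_inv (l : LittleInterval) (x : ℝ) : l.app (l.inv x) = x := by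
  have := l.pos.ne'
  simp only [app, inv]; field_simp; ring

theorem inv_mem_Ioo (l : LittleInterval) (x : ℝ) : l.inv x ∈ Set.Ioo (-1 : ℝ) 1 ↔ x ∈ l.core := by
  simp only [inv, core, Set.mem_Ioo, lt_div_iff₀ l.pos, div_lt_iff₀ l.pos]
  constructor <;> rintro ⟨h1, h2⟩ <;> constructor <;> linarith

theorem app_mem_core (l : LittleInterval) (x : ℝ) : l.app x ∈ l.core ↔ x ∈ Set.Ioo (-1 : ℝ) 1 := by
  rw [← inv_mem_Ioo, inv_app]

theorem image_eq (l : LittleInterval) : l.image = Set.Icc (l.b - l.a) (l.b + l.a) := by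
  ext x
  constructor
  · rintro ⟨y, ⟨h1, h2⟩, rfl⟩
    have := l.pos
    constructor <;> simp only [app] <;> nlinarith
  · rintro ⟨h1, h2⟩
    refine ⟨l.inv x, ?_, l.app_inv x⟩
    simp only [inv, Set.mem_Icc, le_div_iff₀ l.pos, div_le_iff₀ l.pos]
    constructor <;> linarith

theorem interior_image (l : LittleInterval) : interior l.image = l.core := by
  rw [image_eq, interior_Icc, core]

theorem core_subset_image (l : LittleInterval) : l.core ⊆ l.image := by
  rw [← interior_image]; exact interior_subset

theorem core_subset (l : LittleInterval) : l.core ⊆ Set.Ioo (-1 : ℝ) 1 :=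
  fun _ hx => ⟨by linarith [hx.1, l.lower], by linarith [hx.2, l.upper]⟩

theorem isOpen_core (l : LittleInterval) : IsOpen l.core := isOpen_Ioo

theorem closure_core (l : LittleInterval) : closure l.core = l.image := by
  rw [core, closure_Ioo (by linarith [l.pos]), image_eq]

theorem mem_core_comp (l p : LittleInterval) (x : ℝ) : x ∈ (l.comp p).core ↔ l.inv x ∈ p.core := by
  have h := l.pos
  simp only [core, comp, inv, Set.mem_Ioo, lt_div_iff₀ h, div_lt_iff₀ h]
  constructor <;> rintro ⟨h1, h2⟩ <;> constructor <;> linarith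

theorem core_comp_subset (l p : LittleInterval) : (l.comp p).core ⊆ l.core := fun x hx => by
  rw [← inv_mem_Ioo]
  exact p.core_subset ((mem_core_comp l p x).1 hx)

theorem app_comp (l p : LittleInterval) (x : ℝ) : (l.comp p).app x = l.app (p.app x) := by
  simp only [app, comp]; ring

theorem inv_comp (l p : LittleInterval) (x : ℝ) : (l.comp p).inv x = p.inv (l.inv x) := by
  have := l.pos.ne'
  have := p.pos.ne'
  simp only [inv, comp]; field_simp; ring

theorem continuous_ab : Continuous (fun l : LittleInterval => (l.a, l.b)) := continuous_induced_dom

@[fun_prop]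
theorem continuous_a : Continuous LittleInterval.a := continuous_fst.comp continuous_ab

@[fun_prop]
theorem continuous_b : Continuous LittleInterval.b := continuous_snd.comp continuous_ab

/-- The self-homeomorphism `l × id` of the cylinder. -/
def cylHomeo (l : LittleInterval) : Cyl ≃ₜ Cyl where
  toFun := Prod.map l.app id
  invFun := Prod.map l.inv id
  left_inv p := Prod.ext (l.inv_app _) rfl
  right_inv p := Prod.ext (l.app_inv _) rfl
  continuous_toFun := by unfold app; fun_prop
  continuous_invFun := by unfold inv; fun_prop

theorem map_app_eq (l : LittleInterval) :
    (Prod.map l.app id : Cyl → Cyl) = stretch (l.a, l.b) := rfl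

theorem map_inv_eq (l : LittleInterval) :
    (Prod.map l.inv id : Cyl → Cyl) = stretch (l.a⁻¹, -(l.b / l.a)) := by
  funext p
  refine Prod.ext ?_ rfl
  simp only [Prod.map, inv, stretch]
  ring

theorem smoothFamily_app :
    SmoothFamily (fun l : LittleInterval => (Prod.map l.app id : Cyl → Cyl)) := by
  simp only [map_app_eq]
  exact smoothFamily_stretch.precomp (φ := fun l : LittleInterval => (l.a, l.b)) (by fun_prop)

theorem smoothFamily_inv :
    SmoothFamily (fun l : LittleInterval => (Prod.map l.inv id : Cyl → Cyl)) := by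
  simp only [map_inv_eq]
  have h : ∀ l : LittleInterval, l.a ≠ 0 := fun l => l.pos.ne'
  exact smoothFamily_stretch.precomp (φ := fun l : LittleInterval => (l.a⁻¹, -(l.b / l.a)))
    (by fun_prop (disch := exact h _))

theorem isSmoothImmersion_app (l : LittleInterval) :
    IsSmoothImmersion (Prod.map l.app id : Cyl → Cyl) := by
  refine .of_leftInverse (smoothFamily_app.smooth l)
    (h := fun q : ℝ × Plane => (l.inv q.1, q.2)) (by unfold inv; fun_prop) fun p => ?_
  exact Prod.ext (l.inv_app _) rfl

theorem isSmoothImmersion_inv (l : LittleInterval) :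
    IsSmoothImmersion (Prod.map l.inv id : Cyl → Cyl) := by
  refine .of_leftInverse (smoothFamily_inv.smooth l)
    (h := fun q : ℝ × Plane => (l.app q.1, q.2)) (by unfold app; fun_prop) fun p => ?_
  exact Prod.ext (l.app_inv _) rfl

theorem isEmbedding_app (l : LittleInterval) :
    Topology.IsEmbedding (Prod.map l.app id : Cyl → Cyl) := l.cylHomeo.isEmbedding

theorem isEmbedding_inv (l : LittleInterval) :
    Topology.IsEmbedding (Prod.map l.inv id : Cyl → Cyl) := l.cylHomeo.symm.isEmbedding

end LittleInterval

theorem SmoothFamily.knotAct {X : Type*} [TopologicalSpace X] {l : X → LittleInterval}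
    {F : X → Cyl → Cyl} (hl : Continuous l) (hF : SmoothFamily F) :
    SmoothFamily (fun x => knotAct (l x) (F x)) :=
  (LittleInterval.smoothFamily_app.precomp hl).comp
    (hF.comp (LittleInterval.smoothFamily_inv.precomp hl))

theorem IsSmoothImmersion.knotAct {f : Cyl → Cyl} (hf : IsSmoothImmersion f) (l : LittleInterval) :
    IsSmoothImmersion (knotAct l f) :=
  l.isSmoothImmersion_app.comp (hf.comp l.isSmoothImmersion_inv)

/-- The projection is open and continuous, so closures pull back along it. This extends the boundary
conditions from outside J to its endpoints, which allows supports to be described by open intervals.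
-/
theorem closure_axis_compl :
    closure {p : Cyl | p.1 ∉ Set.Icc (-1 : ℝ) 1} = {p : Cyl | p.1 ∉ Set.Ioo (-1 : ℝ) 1} := by
  have h := (isOpenMap_fst (X := ℝ) (Y := Disc)).preimage_closure_eq_closure_preimage
    continuous_fst (Set.Icc (-1 : ℝ) 1)ᶜ
  rw [closure_compl, interior_Icc] at h
  exact h.symm

theorem contDiffOn_id : ContDiffOn ℝ ∞ (ambient id) cylSet :=
  contDiff_id.contDiffOn.congr (eqOn_ambient fun _ => rfl)

/-! ## The topological monoid of framed long knots -/

namespace FramedKnot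

theorem eq_id_of_notMem (f : FramedKnot) {p : Cyl} (hp : p.1 ∉ Set.Ioo (-1 : ℝ) 1) :
    f.toFun p = p := by
  have h1 : IsClosed {p : Cyl | f.toFun p = p} := isClosed_eq f.isEmbedding.continuous continuous_id
  have h2 : closure {p : Cyl | p.1 ∉ Set.Icc (-1 : ℝ) 1} ⊆ {p : Cyl | f.toFun p = p} :=
    closure_minimal (fun p hp => f.eq_id p hp) h1
  rw [closure_axis_compl] at h2
  exact h2 hp

/-- If f(p) lay outside the open part, it would be fixed by f, and injectivity would give f(p) = p.
For links the analogous condition is part of the structure. -/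
theorem mapsTo_interior (f : FramedKnot) {p : Cyl} (hp : p.1 ∈ Set.Ioo (-1 : ℝ) 1) :
    (f.toFun p).1 ∈ Set.Ioo (-1 : ℝ) 1 := by
  by_contra h
  rw [f.isEmbedding.injective (f.eq_id_of_notMem h)] at h
  exact h hp

theorem smoothFamily : SmoothFamily FramedKnot.toFun :=
  .of_continuous (fun f => f.immersion.smooth) fun n =>
    continuous_iInf_dom (i := n) continuous_induced_dom

theorem continuous_of_smoothFamily {X : Type*} [TopologicalSpace X] {F : X → FramedKnot}
    (hF : SmoothFamily (fun x => (F x).toFun)) : Continuous F :=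
  continuous_iInf_rng.2 fun n => continuous_induced_rng.2 (hF.continuous n)

instance : Monoid FramedKnot where
  one :=
    { toFun := id
      isEmbedding := .id
      immersion := .of_leftInverse contDiffOn_id differentiable_id fun _ => rfl
      eq_id := fun _ _ => rfl }
  mul f g :=
    { toFun := f.toFun ∘ g.toFun
      isEmbedding := f.isEmbedding.comp g.isEmbedding
      immersion := f.immersion.comp g.immersion
      eq_id := fun p hp => by
        rw [Function.comp_apply, g.eq_id p hp, f.eq_id p hp] }
  mul_assoc _ _ _ := rfl
  one_mul _ := rfl
  mul_one _ := rfl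

theorem toFun_one : (1 : FramedKnot).toFun = id := rfl

theorem toFun_mul (f g : FramedKnot) : (f * g).toFun = f.toFun ∘ g.toFun := rfl

instance : ContinuousMul FramedKnot :=
  ⟨continuous_of_smoothFamily
    -- The tautological family of all framed knots is smooth, so continuity of the product is the
    -- composition rule applied to its two pullbacks.
    ((smoothFamily.precomp continuous_fst).comp (smoothFamily.precomp continuous_snd))⟩

theorem toFun_list_prod (ℓ : List FramedKnot) :
    ℓ.prod.toFun = (ℓ.map FramedKnot.toFun).foldr (fun g h => g ∘ h) id := by
  induction ℓ with
  | nil => rfl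
  | cons a ℓ ih => rw [List.prod_cons, toFun_mul, ih]; rfl

theorem knotAct_eq_id (l : LittleInterval) (f : FramedKnot) {p : Cyl} (hp : p.1 ∉ l.core) :
    knotAct l f.toFun p = p := by
  have h : ((Prod.map l.inv id p : Cyl)).1 ∉ Set.Ioo (-1 : ℝ) 1 := by
    rwa [Prod.map_fst, l.inv_mem_Ioo]
  simp only [knotAct, Function.comp_apply, f.eq_id_of_notMem h]
  exact Prod.ext (l.app_inv _) rfl

theorem knotAct_mem_core (l : LittleInterval) (f : FramedKnot) {p : Cyl} (hp : p.1 ∈ l.core) :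
    (knotAct l f.toFun p).1 ∈ l.core := by
  simp only [knotAct, Function.comp_apply, Prod.map_fst, l.app_mem_core]
  apply f.mapsTo_interior
  rwa [Prod.map_fst, l.inv_mem_Ioo]

/-- The action of a little interval, as an endomorphism of the monoid of framed long knots. -/
def conj (l : LittleInterval) : FramedKnot →* FramedKnot where
  toFun f :=
    { toFun := knotAct l f.toFun
      isEmbedding := l.isEmbedding_app.comp (f.isEmbedding.comp l.isEmbedding_inv)
      immersion := f.immersion.knotAct l
      eq_id := fun _ hp => knotAct_eq_id l f fun h =>
        hp (Set.Ioo_subset_Icc_self (l.core_subset h)) }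
  map_one' := FramedKnot.ext (funext fun p => Prod.ext (l.app_inv _) rfl)
  map_mul' f g := FramedKnot.ext (funext fun p => by
    simp only [knotAct, toFun_mul, Function.comp_apply]
    congr 2
    exact Prod.ext (l.inv_app _).symm rfl)

@[simp]
theorem toFun_conj (l : LittleInterval) (f : FramedKnot) :
    (conj l f).toFun = knotAct l f.toFun := rfl

theorem continuous_conj :
    Continuous (fun x : LittleInterval × FramedKnot => conj x.1 x.2) :=
  continuous_of_smoothFamily (.knotAct continuous_fst (smoothFamily.precomp continuous_snd))

theorem conj_comp (l p : LittleInterval) (f : FramedKnot) :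
    conj (l.comp p) f = conj l (conj p f) := by
  refine FramedKnot.ext (funext fun x => ?_)
  simp only [toFun_conj, knotAct, Function.comp_apply]
  have h : (Prod.map (l.comp p).inv id x : Cyl) = Prod.map p.inv id (Prod.map l.inv id x : Cyl) :=
    Prod.ext (LittleInterval.inv_comp _ _ _) rfl
  rw [h]
  exact Prod.ext (LittleInterval.app_comp _ _ _) rfl

theorem conj_one (f : FramedKnot) : conj LittleInterval.one f = f := by
  refine FramedKnot.ext (funext fun x => ?_)
  have h : (Prod.map LittleInterval.one.inv id x : Cyl) = x :=
    Prod.ext (by simp [LittleInterval.inv, LittleInterval.one]) rfl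
  simp only [toFun_conj, knotAct, Function.comp_apply, h]
  exact Prod.ext (by simp [LittleInterval.app, LittleInterval.one]) rfl

/-- Each factor is the identity off its own core and preserves its core, so at any point at most one
of the two factors acts. -/
theorem commute_conj {l p : LittleInterval} (h : Disjoint l.core p.core) (f g : FramedKnot) :
    Commute (conj l f) (conj p g) := by
  refine FramedKnot.ext (funext fun x => ?_)
  simp only [toFun_mul, toFun_conj, Function.comp_apply]
  by_cases h1 : x.1 ∈ l.core
  · rw [knotAct_eq_id p g (Set.disjoint_left.1 h h1),
      knotAct_eq_id p g (Set.disjoint_left.1 h (knotAct_mem_core l f h1))]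
  · by_cases h2 : x.1 ∈ p.core
    · rw [knotAct_eq_id l f h1,
        knotAct_eq_id l f (Set.disjoint_right.1 h (knotAct_mem_core p g h2))]
    · rw [knotAct_eq_id l f h1, knotAct_eq_id p g h2, knotAct_eq_id l f h1]

end FramedKnot

/-! ## The space of framed string links -/

/-- One of the two inclusions of the cylinder in `Cyl ⊕ Cyl`. -/
def strand (e : Bool) : Cyl → Cyl ⊕ Cyl := if e then Sum.inl else Sum.inr

theorem exists_strand (p : Cyl ⊕ Cyl) : ∃ e q, strand e q = p := by
  rcases p with p | p
  · exact ⟨true, p, rfl⟩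
  · exact ⟨false, p, rfl⟩

@[simp]
theorem axial_strand (e : Bool) (p : Cyl) : axial (strand e p) = p.1 := by cases e <;> rfl

theorem continuous_axial : Continuous axial := continuous_fst.sumElim continuous_fst

theorem axial_sumMap {u d : Cyl → Cyl} {S : Set ℝ} (hu : ∀ p, p.1 ∈ S → (u p).1 ∈ S)
    (hd : ∀ p, p.1 ∈ S → (d p).1 ∈ S) {p : Cyl ⊕ Cyl} (hp : axial p ∈ S) :
    axial (Sum.map u d p) ∈ S := by
  rcases p with p | p
  · exact hu p hp
  · exact hd p hp

theorem stdLink_fst (p : Cyl ⊕ Cyl) : (stdLink p).1 = axial p := by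
  rcases p with p | p <;> rfl

/-- The height in the disc of a strand of the standard link. -/
def strandHeight (e : Bool) : ℝ := if e then 1 / 2 else -(1 / 2)

theorem toAmbient_stdLink (e : Bool) (p : Cyl) :
    toAmbient (stdLink (strand e p)) = (p.1, (1 / 8 : ℝ) • p.2.1 + !₂[0, strandHeight e]) := by
  cases e <;> rfl

theorem isSmoothImmersion_stdLink (e : Bool) :
    IsSmoothImmersion (fun p => stdLink (strand e p)) := by
  refine .of_leftInverse
    (h := fun q : ℝ × Plane => (q.1, (8 : ℝ) • (q.2 - !₂[0, strandHeight e]))) ?_ (by fun_prop) ?_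
  · refine ContDiffOn.congr (ContDiff.contDiffOn (by fun_prop)) (eqOn_ambient
      (g := fun q : ℝ × Plane => (q.1, (1 / 8 : ℝ) • q.2 + !₂[0, strandHeight e]))
      (toAmbient_stdLink e))
  · intro p
    rw [toAmbient_stdLink]
    refine Prod.ext rfl ?_
    simp [smul_smul, toAmbient]

/-- The second coordinate in the disc separates the strands: they stay within 1/8 of 1/2 and of
-1/2. A single strand is injective because it is a scaling followed by a translation. -/
theorem stdLink_injective : Function.Injective stdLink := by
  have hne : ∀ p q : Cyl, stdLink (strand true p) ≠ stdLink (strand false q) := by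
    intro p q h
    have h := congrArg (fun z => (toAmbient z).2 1) h
    simp only [toAmbient_stdLink, strandHeight] at h
    simp at h
    have h1 := (Real.norm_eq_abs _ ▸ PiLp.norm_apply_le p.2.1 1 : |p.2.1 1| ≤ _).trans
      (mem_closedBall_zero_iff.1 p.2.2)
    have h2 := (Real.norm_eq_abs _ ▸ PiLp.norm_apply_le q.2.1 1 : |q.2.1 1| ≤ _).trans
      (mem_closedBall_zero_iff.1 q.2.2)
    rw [abs_le] at h1 h2
    linarith
  have hinj : ∀ e, ∀ p q : Cyl, stdLink (strand e p) = stdLink (strand e q) → p = q := by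
    intro e p q h
    have h := congrArg toAmbient h
    simp only [toAmbient_stdLink, Prod.mk.injEq, add_left_inj] at h
    exact Prod.ext h.1 (Subtype.ext (smul_right_injective _ (by norm_num : (1 / 8 : ℝ) ≠ 0) h.2))
  intro p q h
  obtain ⟨e, p, rfl⟩ := exists_strand p
  obtain ⟨e', q, rfl⟩ := exists_strand q
  cases e <;> cases e'
  · rw [hinj _ _ _ h]
  · exact (hne _ _ h.symm).elim
  · exact (hne _ _ h).elim
  · rw [hinj _ _ _ h]

theorem closure_axial_compl :
    closure {p : Cyl ⊕ Cyl | axial p ∉ Set.Icc (-1 : ℝ) 1} =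
      {p | axial p ∉ Set.Ioo (-1 : ℝ) 1} := by
  have h := ((isOpenMap_fst (X := ℝ) (Y := Disc)).sumElim
    isOpenMap_fst).preimage_closure_eq_closure_preimage continuous_axial (Set.Icc (-1 : ℝ) 1)ᶜ
  rw [closure_compl, interior_Icc] at h
  exact h.symm

theorem stdLink_map_inv (l : LittleInterval) (p : Cyl ⊕ Cyl) :
    (Prod.map l.app id (stdLink (Sum.map (Prod.map l.inv id) (Prod.map l.inv id) p)) : Cyl) =
      stdLink p := by
  rcases p with p | p <;> exact Prod.ext (l.app_inv _) rfl

theorem axial_map_inv (l : LittleInterval) (p : Cyl ⊕ Cyl) :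
    axial (Sum.map (Prod.map l.inv id) (Prod.map l.inv id) p) = l.inv (axial p) := by
  rcases p with p | p <;> rfl

namespace FramedLink

theorem eq_std_of_notMem (f : FramedLink) {p : Cyl ⊕ Cyl} (hp : axial p ∉ Set.Ioo (-1 : ℝ) 1) :
    f.toFun p = stdLink p := by
  have hc : Continuous stdLink := by
    refine continuous_sum_dom.2 ⟨?_, ?_⟩
    · exact continuous_of_contDiffOn (isSmoothImmersion_stdLink true).smooth
    · exact continuous_of_contDiffOn (isSmoothImmersion_stdLink false).smooth
  have h1 : IsClosed {p | f.toFun p = stdLink p} := isClosed_eq f.isEmbedding.continuous hc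
  have h2 : closure {p | axial p ∉ Set.Icc (-1 : ℝ) 1} ⊆ {p | f.toFun p = stdLink p} :=
    closure_minimal (fun p hp => f.eq_std p hp) h1
  rw [closure_axial_compl] at h2
  exact h2 hp

theorem immersion (f : FramedLink) (e : Bool) :
    IsSmoothImmersion (fun p => f.toFun (strand e p)) := by
  cases e
  · exact f.immersion_down
  · exact f.immersion_up

theorem smoothFamily (e : Bool) :
    SmoothFamily (fun (f : FramedLink) p => f.toFun (strand e p)) := by
  refine .of_continuous (fun f => (f.immersion e).smooth) fun n => ?_
  have h : Continuous (fun f : FramedLink =>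
      (jet n (fun p => f.toFun (Sum.inl p)), jet n (fun p => f.toFun (Sum.inr p)))) :=
    continuous_iInf_dom (i := n) continuous_induced_dom
  cases e
  · exact continuous_snd.comp h
  · exact continuous_fst.comp h

theorem continuous_of_smoothFamily {X : Type*} [TopologicalSpace X] {F : X → FramedLink}
    (hF : ∀ e, SmoothFamily (fun x p => (F x).toFun (strand e p))) : Continuous F :=
  continuous_iInf_rng.2 fun n => continuous_induced_rng.2
    (((hF true).continuous n).prodMk ((hF false).continuous n))

/-- Such a map is proper: outside J it preserves the axial coordinate, so the preimage of a compact
K lies over the union of J and the axial projection of K, and D² is compact. A proper continuous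
injection is a closed embedding. -/
theorem isClosedEmbedding_of_eq_std {g : Cyl ⊕ Cyl → Cyl} (hc : Continuous g)
    (hi : Function.Injective g) (hstd : ∀ p, axial p ∉ Set.Icc (-1 : ℝ) 1 → g p = stdLink p) :
    Topology.IsClosedEmbedding g := by
  have key : ∀ S : Set ℝ, IsCompact S → IsCompact (axial ⁻¹' S) := by
    intro S hS
    have h1 : IsCompact (S ×ˢ (Set.univ : Set Disc)) := hS.prod isCompact_univ
    have h2 : axial ⁻¹' S = Sum.inl '' (S ×ˢ (Set.univ : Set Disc)) ∪
        Sum.inr '' (S ×ˢ (Set.univ : Set Disc)) := by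
      ext p
      rcases p with p | p <;> simp [axial]
    rw [h2]
    exact (h1.image continuous_inl).union (h1.image continuous_inr)
  refine .of_continuous_injective_isClosedMap hc hi (IsProperMap.isClosedMap ?_)
  refine isProperMap_iff_isCompact_preimage.2 ⟨hc, fun K hK => ?_⟩
  refine ((key _ (isCompact_Icc (a := (-1 : ℝ)) (b := 1))).union
    (key _ (hK.image continuous_fst))).of_isClosed_subset (hK.isClosed.preimage hc) fun p hp => ?_
  by_cases h : axial p ∈ Set.Icc (-1 : ℝ) 1
  · exact Or.inl h
  · refine Or.inr ⟨g p, hp, ?_⟩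
    rw [hstd p h, stdLink_fst]

theorem sandwich_eq_std (k : FramedKnot) (g : FramedLink) (u d : FramedKnot) (p : Cyl ⊕ Cyl)
    (hp : axial p ∉ Set.Icc (-1 : ℝ) 1) :
    (k.toFun ∘ g.toFun ∘ Sum.map u.toFun d.toFun) p = stdLink p := by
  have h1 : Sum.map u.toFun d.toFun p = p := by
    rcases p with p | p
    · exact congrArg Sum.inl (u.eq_id p hp)
    · exact congrArg Sum.inr (d.eq_id p hp)
  rw [Function.comp_apply, Function.comp_apply, h1, g.eq_std p hp,
    k.eq_id _ (by rwa [stdLink_fst])]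

/-- The composite `k ∘ g ∘ (u ⨿ d)` of a framed link with framed knots. -/
def sandwich (k : FramedKnot) (g : FramedLink) (u d : FramedKnot) : FramedLink where
  toFun := k.toFun ∘ g.toFun ∘ Sum.map u.toFun d.toFun
  -- Only continuity and injectivity have to be composed; properness supplies the rest.
  isEmbedding := (isClosedEmbedding_of_eq_std
    (k.isEmbedding.continuous.comp (g.isEmbedding.continuous.comp
      (u.isEmbedding.continuous.sumMap d.isEmbedding.continuous)))
    (k.isEmbedding.injective.comp (g.isEmbedding.injective.comp
      (u.isEmbedding.injective.sumMap d.isEmbedding.injective)))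
    (sandwich_eq_std k g u d)).isEmbedding
  immersion_up := k.immersion.comp (g.immersion_up.comp u.immersion)
  immersion_down := k.immersion.comp (g.immersion_down.comp d.immersion)
  eq_std := sandwich_eq_std k g u d
  mapsTo_interior _ hp := k.mapsTo_interior <| g.mapsTo_interior _ <|
    axial_sumMap (fun _ => u.mapsTo_interior) (fun _ => d.mapsTo_interior) hp

theorem continuous_sandwich {X : Type*} [TopologicalSpace X] {k u d : X → FramedKnot}
    {g : X → FramedLink} (hk : Continuous k) (hg : Continuous g) (hu : Continuous u)
    (hd : Continuous d) : Continuous (fun x => sandwich (k x) (g x) (u x) (d x)) := by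
  refine continuous_of_smoothFamily fun e => ?_
  refine (FramedKnot.smoothFamily.precomp hk).comp ?_
  cases e
  · exact ((smoothFamily false).precomp hg).comp (FramedKnot.smoothFamily.precomp hd)
  · exact ((smoothFamily true).precomp hg).comp (FramedKnot.smoothFamily.precomp hu)

theorem linkAct_eq_std (l : LittleInterval) (f : FramedLink) {p : Cyl ⊕ Cyl}
    (hp : axial p ∉ l.core) : linkAct l f.toFun p = stdLink p := by
  simp only [linkAct, Function.comp_apply]
  rw [f.eq_std_of_notMem (by rwa [axial_map_inv, l.inv_mem_Ioo]), stdLink_map_inv]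

theorem linkAct_mem_core (l : LittleInterval) (f : FramedLink) {p : Cyl ⊕ Cyl}
    (hp : axial p ∈ l.core) : (linkAct l f.toFun p).1 ∈ l.core := by
  simp only [linkAct, Function.comp_apply, Prod.map_fst, l.app_mem_core]
  apply f.mapsTo_interior
  rwa [axial_map_inv, l.inv_mem_Ioo]

theorem linkAct_strand (l : LittleInterval) (f : Cyl ⊕ Cyl → Cyl) (e : Bool) :
    (fun p => linkAct l f (strand e p)) = knotAct l (fun p => f (strand e p)) := by
  cases e <;> rfl

theorem linkAct_injective (l : LittleInterval) (f : FramedLink) :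
    Function.Injective (linkAct l f.toFun) :=
  l.cylHomeo.injective.comp (f.isEmbedding.injective.comp
    (l.cylHomeo.symm.injective.sumMap l.cylHomeo.symm.injective))

/-! ### Concatenation -/

/-- The map `g` is the concatenation of the links in `S` according to the intervals in `S`. -/
structure IsConcat (S : Set (LittleInterval × FramedLink)) (g : Cyl ⊕ Cyl → Cyl) : Prop where
  on_core : ∀ x ∈ S, ∀ p, axial p ∈ x.1.core → g p = linkAct x.1 x.2.toFun p
  off_core : ∀ p, (∀ x ∈ S, axial p ∉ x.1.core) → g p = stdLink p

theorem IsConcat.unique {S : Set (LittleInterval × FramedLink)} {g g' : Cyl ⊕ Cyl → Cyl}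
    (h : IsConcat S g) (h' : IsConcat S g') : g = g' := by
  funext p
  by_cases hp : ∃ x ∈ S, axial p ∈ x.1.core
  · obtain ⟨x, hx, hp⟩ := hp
    rw [h.on_core x hx p hp, h'.on_core x hx p hp]
  · push Not at hp
    rw [h.off_core p hp, h'.off_core p hp]

section Concat

variable {ι : Type} {x : ι → LittleInterval × FramedLink}

/-- At an endpoint of the interval both sides are standard: the other cores are open and disjoint
from this core, hence also from its closure. -/
theorem IsConcat.on_image (hx : Pairwise fun i j => Disjoint (x i).1.core (x j).1.core)
    {g : Cyl ⊕ Cyl → Cyl} (h : IsConcat (Set.range x) g) (i : ι) {p : Cyl ⊕ Cyl}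
    (hp : axial p ∈ (x i).1.image) : g p = linkAct (x i).1 (x i).2.toFun p := by
  by_cases hpi : axial p ∈ (x i).1.core
  · exact h.on_core _ ⟨i, rfl⟩ p hpi
  · rw [linkAct_eq_std _ _ hpi, h.off_core]
    rintro _ ⟨j, rfl⟩ hj
    rcases eq_or_ne i j with rfl | hij
    · exact hpi hj
    · have := (hx hij).closure_left (x j).1.isOpen_core
      rw [LittleInterval.closure_core] at this
      exact Set.disjoint_left.1 this hp hj

/-- The differences have disjoint supports, so at each point at most one term is nonzero. This
global formula is what gives smoothness without gluing at endpoints. -/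
theorem IsConcat.toAmbient_eq [Fintype ι]
    (hx : Pairwise fun i j => Disjoint (x i).1.core (x j).1.core)
    {g : Cyl ⊕ Cyl → Cyl} (h : IsConcat (Set.range x) g) (p : Cyl ⊕ Cyl) :
    toAmbient (g p) = toAmbient (stdLink p) +
      ∑ i, (toAmbient (linkAct (x i).1 (x i).2.toFun p) - toAmbient (stdLink p)) := by
  by_cases hp : ∃ i, axial p ∈ (x i).1.core
  · obtain ⟨i, hp⟩ := hp
    rw [Finset.sum_eq_single i, h.on_core _ ⟨i, rfl⟩ p hp]
    · abel
    · intro j _ hj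
      rw [linkAct_eq_std _ _ (Set.disjoint_right.1 (hx hj) hp), sub_self]
    · simp
  · push Not at hp
    rw [Finset.sum_eq_zero, h.off_core p (by rintro _ ⟨i, rfl⟩; exact hp i), add_zero]
    intro i _
    rw [linkAct_eq_std _ _ (hp i), sub_self]

theorem IsConcat.smoothFamily [Fintype ι] {X : Type*} [TopologicalSpace X]
    {x : X → ι → LittleInterval × FramedLink}
    (hx : ∀ z, Pairwise fun i j => Disjoint (x z i).1.core (x z j).1.core)
    (hc : ∀ i, Continuous fun z => x z i) {g : X → Cyl ⊕ Cyl → Cyl}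
    (h : ∀ z, IsConcat (Set.range (x z)) (g z)) (e : Bool) :
    SmoothFamily (fun z p => g z (strand e p)) := by
  have hA : ∀ o : Option ι, SmoothFamily (X := X) (fun z p => o.elim (stdLink (strand e p))
      fun i => linkAct (x z i).1 (x z i).2.toFun (strand e p)) := by
    rintro (_ | i)
    · exact .const (isSmoothImmersion_stdLink e).smooth
    · have := SmoothFamily.knotAct (continuous_fst.comp (hc i))
        ((FramedLink.smoothFamily e).precomp (continuous_snd.comp (hc i)))
      simp only [← linkAct_strand] at this
      exact this
  -- The index `none` stands for the standard link. Its coefficient is 1 minus the number of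
  -- intervals, because each difference subtracts it once.
  refine SmoothFamily.of_sum_smul Finset.univ
    (a := fun _ o => o.elim (1 - (Fintype.card ι : ℝ)) fun _ => 1) (fun _ => continuous_const)
    (fun z o => (hA o).smooth z) (fun o n => (hA o).continuous_jet n) fun z p => ?_
  rw [(h z).toAmbient_eq (hx z)]
  simp only [Fintype.sum_option, Option.elim, ambient_toAmbient, one_smul, Finset.sum_sub_distrib,
    Finset.sum_const, Finset.card_univ, sub_smul, Nat.cast_smul_eq_nsmul]
  abel

theorem IsConcat.continuous [Fintype ι] {X : Type*} [TopologicalSpace X]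
    {x : X → ι → LittleInterval × FramedLink}
    (hx : ∀ z, Pairwise fun i j => Disjoint (x z i).1.core (x z j).1.core)
    (hc : ∀ i, Continuous fun z => x z i) {g : X → FramedLink}
    (h : ∀ z, IsConcat (Set.range (x z)) (g z).toFun) : Continuous g :=
  continuous_of_smoothFamily fun e => IsConcat.smoothFamily hx hc h e

theorem IsConcat.isSmoothImmersion [Fintype ι]
    (hx : Pairwise fun i j => Disjoint (x i).1.core (x j).1.core)
    {g : Cyl ⊕ Cyl → Cyl} (h : IsConcat (Set.range x) g) (e : Bool) :
    IsSmoothImmersion (fun p => g (strand e p)) := by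
  have hs : ContDiffOn ℝ ∞ (ambient fun p => g (strand e p)) cylSet :=
    (IsConcat.smoothFamily (X := Unit) (x := fun _ => x) (fun _ => hx) (fun _ => continuous_const)
      (fun _ => h) e).smooth ()
  refine ⟨hs, fun p => ?_⟩
  -- Injectivity of the derivative is checked over the closed images, where the map is a conjugated
  -- link, and over their open complement, where it is standard. Together these cover the axis.
  by_cases hp : ∃ i, p.1 ∈ (x i).1.image
  · obtain ⟨i, hp⟩ := hp
    have hi : IsSmoothImmersion fun p => linkAct (x i).1 (x i).2.toFun (strand e p) := by
      rw [linkAct_strand]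
      exact ((x i).2.immersion e).knotAct _
    rw [fderivWithin_ambient_congr hs hi.smooth (V := (x i).1.image)
      (by rw [LittleInterval.image_eq]
          exact uniqueDiffOn_Icc (by linarith [(x i).1.pos]))
      (fun q hq => h.on_image hx i (by rwa [axial_strand])) hp]
    exact hi.injective_fderiv p
  · have hi := isSmoothImmersion_stdLink e
    rw [fderivWithin_ambient_congr hs hi.smooth (V := (⋃ i, (x i).1.image)ᶜ)
      (IsOpen.uniqueDiffOn (isClosed_iUnion_of_finite fun i => by
        rw [LittleInterval.image_eq]; exact isClosed_Icc).isOpen_compl)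
      (fun _ hq => ?_) (by simpa using hp)]
    · exact hi.injective_fderiv p
    · refine h.off_core _ ?_
      rintro _ ⟨i, rfl⟩ hi
      rw [axial_strand] at hi
      exact hq (Set.mem_iUnion.2 ⟨i, (x i).1.core_subset_image hi⟩)

theorem IsConcat.fst_mem_core {S : Set (LittleInterval × FramedLink)} {g : Cyl ⊕ Cyl → Cyl}
    (h : IsConcat S g) {y : LittleInterval × FramedLink} (hy : y ∈ S) {p : Cyl ⊕ Cyl}
    (hp : axial p ∈ y.1.core) : (g p).1 ∈ y.1.core := by
  rw [h.on_core y hy p hp]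
  exact linkAct_mem_core _ _ hp

/-- A point over a core stays over it, and a point over no core keeps its axial coordinate. Two
points with the same image are thus both over the same core or both over none. -/
theorem IsConcat.injective {S : Set (LittleInterval × FramedLink)} {g : Cyl ⊕ Cyl → Cyl}
    (hS : S.Pairwise fun y z => Disjoint y.1.core z.1.core)
    (h : IsConcat S g) : Function.Injective g := by
  have key : ∀ p q, g p = g q → ∀ y ∈ S, axial p ∈ y.1.core → p = q := by
    intro p q hpq y hy hp
    have hp' := h.fst_mem_core hy hp
    by_cases hq : ∃ z ∈ S, axial q ∈ z.1.core
    · obtain ⟨z, hz, hq⟩ := hq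
      have hyz : y = z := by
        by_contra hne
        exact Set.disjoint_left.1 (hS hy hz hne) hp' (hpq ▸ h.fst_mem_core hz hq)
      subst hyz
      rw [h.on_core y hy p hp, h.on_core y hy q hq] at hpq
      exact linkAct_injective _ _ hpq
    · push Not at hq
      rw [hpq, h.off_core q hq, stdLink_fst] at hp'
      exact (hq y hy hp').elim
  intro p q hpq
  by_cases hp : ∃ y ∈ S, axial p ∈ y.1.core
  · obtain ⟨y, hy, hp⟩ := hp
    exact key p q hpq y hy hp
  · by_cases hq : ∃ y ∈ S, axial q ∈ y.1.core
    · obtain ⟨y, hy, hq⟩ := hq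
      exact (key q p hpq.symm y hy hq).symm
    · push Not at hp hq
      rw [h.off_core p hp, h.off_core q hq] at hpq
      exact stdLink_injective hpq

theorem IsConcat.mapsTo_interior {S : Set (LittleInterval × FramedLink)} {g : Cyl ⊕ Cyl → Cyl}
    (h : IsConcat S g) {p : Cyl ⊕ Cyl} (hp : axial p ∈ Set.Ioo (-1 : ℝ) 1) :
    (g p).1 ∈ Set.Ioo (-1 : ℝ) 1 := by
  by_cases hx : ∃ y ∈ S, axial p ∈ y.1.core
  · obtain ⟨y, hy, hx⟩ := hx
    exact y.1.core_subset (h.fst_mem_core hy hx)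
  · push Not at hx
    rwa [h.off_core p hx, stdLink_fst]

theorem IsConcat.eq_std {S : Set (LittleInterval × FramedLink)} {g : Cyl ⊕ Cyl → Cyl}
    (h : IsConcat S g) {p : Cyl ⊕ Cyl} (hp : axial p ∉ Set.Ioo (-1 : ℝ) 1) :
    g p = stdLink p :=
  h.off_core p fun y _ hy => hp (y.1.core_subset hy)

theorem exists_isConcat_fun (hx : Pairwise fun i j => Disjoint (x i).1.core (x j).1.core) :
    ∃ g, IsConcat (Set.range x) g := by
  classical
  refine ⟨fun p => if h : ∃ i, axial p ∈ (x i).1.core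
    then linkAct (x h.choose).1 (x h.choose).2.toFun p else stdLink p, ?_, ?_⟩
  · rintro _ ⟨i, rfl⟩ p hp
    have h : ∃ i, axial p ∈ (x i).1.core := ⟨i, hp⟩
    have hi : h.choose = i := by
      by_contra hne
      exact Set.disjoint_left.1 (hx hne) h.choose_spec hp
    simp only [dif_pos h, hi]
  · intro p hp
    have h : ¬ ∃ i, axial p ∈ (x i).1.core := fun ⟨i, hi⟩ => hp _ ⟨i, rfl⟩ hi
    simp only [dif_neg h]

theorem exists_isConcat [Fintype ι] (hx : Pairwise fun i j => Disjoint (x i).1.core (x j).1.core) :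
    ∃ g : FramedLink, IsConcat (Set.range x) g.toFun := by
  obtain ⟨g, h⟩ := exists_isConcat_fun hx
  have hs := h.isSmoothImmersion hx
  have hstd : ∀ p, axial p ∉ Set.Icc (-1 : ℝ) 1 → g p = stdLink p := fun p hp =>
    h.eq_std fun hp' => hp (Set.Ioo_subset_Icc_self hp')
  have hS : (Set.range x).Pairwise fun y z => Disjoint y.1.core z.1.core := by
    rintro _ ⟨i, rfl⟩ _ ⟨j, rfl⟩ hij
    exact hx fun h => hij (congrArg x h)
  exact ⟨{
    toFun := g
    isEmbedding := (isClosedEmbedding_of_eq_std (continuous_sum_dom.2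
      ⟨continuous_of_contDiffOn (hs true).smooth, continuous_of_contDiffOn (hs false).smooth⟩)
      (h.injective hS) hstd).isEmbedding
    immersion_up := hs true
    immersion_down := hs false
    eq_std := hstd
    mapsTo_interior := fun p hp => h.mapsTo_interior hp }, h⟩

end Concat

end FramedLink

/-! ## Almost disjoint squares -/

namespace LittleCube

theorem interior_image {n : ℕ} (L : LittleCube n) :
    interior L.image = Set.pi Set.univ fun j => (L j).core := by
  have h : L.image = Set.pi Set.univ fun j => (L j).image := by
    ext x
    constructor
    · rintro ⟨y, hy, rfl⟩ j _
      exact ⟨y j, hy j, rfl⟩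
    · intro hx
      choose y hy hyx using fun j => hx j trivial
      exact ⟨y, hy, funext hyx⟩
  rw [h, interior_pi_set Set.finite_univ]
  simp only [LittleInterval.interior_image]

/-- Interiors of squares are products of open intervals, and two products are disjoint exactly when
some pair of factors is. -/
theorem almostDisjoint_iff {L P : LittleCube 2} :
    AlmostDisjoint L P ↔ Disjoint (L 0).core (P 0).core ∨ Disjoint (L 1).core (P 1).core := by
  rw [AlmostDisjoint, interior_image, interior_image, Set.disjoint_univ_pi, Fin.exists_fin_two]

theorem height_eq (L : LittleCube 2) : L.height = (L 1).b - (L 1).a := by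
  simp only [height, LittleInterval.app]; ring

theorem neg_one_le_height (L : LittleCube 2) : -1 ≤ L.height := by
  rw [height_eq]; linarith [(L 1).lower]

/-- The square `L` has a smaller height than `P`, and their projections overlap. -/
def Under (L P : LittleCube 2) : Prop :=
  L.height < P.height ∧ (interior L.proj.image ∩ interior P.proj.image).Nonempty

theorem under_iff {L P : LittleCube 2} :
    Under L P ↔ L.height < P.height ∧ ¬ Disjoint (L 0).core (P 0).core := by
  simp only [Under, LittleInterval.interior_image, Set.not_disjoint_iff_nonempty_inter]
  rfl

/-- The relation is given by strict inequalities between the coefficients. Hence the configurations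
ordered by a given permutation form a closed set. -/
theorem isOpen_under : IsOpen {x : LittleCube 2 × LittleCube 2 | Under x.1 x.2} := by
  have h : {x : LittleCube 2 × LittleCube 2 | Under x.1 x.2} =
      {x | (x.1 1).b - (x.1 1).a < (x.2 1).b - (x.2 1).a ∧
        max ((x.1 0).b - (x.1 0).a) ((x.2 0).b - (x.2 0).a) <
          min ((x.1 0).b + (x.1 0).a) ((x.2 0).b + (x.2 0).a)} := by
    ext x
    simp only [Set.mem_ofPred_eq, under_iff, height_eq, LittleInterval.core, Set.Ioo_disjoint_Ioo,
      not_le]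
  rw [h]
  refine IsOpen.and (isOpen_lt ?_ ?_) (isOpen_lt ?_ ?_) <;> fun_prop

/-- If the projections overlapped, neither height could be smaller than the other. Sides that start
at the same height overlap, so the squares would overlap as well. -/
theorem AlmostDisjoint.disjoint_of_not_under {L P : LittleCube 2} (h : AlmostDisjoint L P)
    (h1 : ¬ Under L P) (h2 : ¬ Under P L) : Disjoint (L 0).core (P 0).core := by
  by_contra hd
  have hv := (almostDisjoint_iff.1 h).resolve_left hd
  rw [under_iff, not_and_not_right] at h1 h2
  have hle : L.height = P.height :=
    le_antisymm (not_lt.1 fun h => hd (h2 h).symm) (not_lt.1 fun h => hd (h1 h))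
  rw [height_eq, height_eq] at hle
  rw [LittleInterval.core, LittleInterval.core, Set.Ioo_disjoint_Ioo, min_le_iff, le_max_iff,
    le_max_iff] at hv
  have := (L 1).pos
  have := (P 1).pos
  rcases hv with (hv | hv) | (hv | hv) <;> linarith

theorem disjoint_of_meetsLowerFace {L P : LittleCube 2} (h : AlmostDisjoint L P)
    (hL : L.MeetsLowerFace) (hP : P.MeetsLowerFace) : Disjoint L.proj.core P.proj.core := by
  refine h.disjoint_of_not_under (fun hu => ?_) fun hu => ?_
  · exact absurd hu.1 (by rw [height, height, hL, hP]; exact lt_irrefl _)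
  · exact absurd hu.1 (by rw [height, height, hL, hP]; exact lt_irrefl _)

/-! ### The order of squares under composition -/

theorem le_of_under {L P : LittleCube 2} (h : AlmostDisjoint L P) (hu : Under L P) :
    (L 1).b + (L 1).a ≤ (P 1).b - (P 1).a := by
  rw [under_iff, height_eq, height_eq] at hu
  have hv := (almostDisjoint_iff.1 h).resolve_left hu.2
  rw [LittleInterval.core, LittleInterval.core, Set.Ioo_disjoint_Ioo, min_le_iff, le_max_iff,
    le_max_iff] at hv
  have := (L 1).pos
  have := (P 1).pos
  have := hu.1
  rcases hv with (hv | hv) | (hv | hv) <;> linarith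

theorem height_comp (L P : LittleCube 2) : (L.comp P).height = (L 1).a * P.height + (L 1).b := by
  simp only [height, comp, LittleInterval.app_comp]
  rfl

theorem height_comp_lt (L P : LittleCube 2) : (L.comp P).height < (L 1).b + (L 1).a := by
  have h : P.height < 1 := by rw [height_eq]; linarith [(P 1).pos, (P 1).upper]
  rw [height_comp]
  nlinarith [(L 1).pos]

theorem height_le_comp (L P : LittleCube 2) : L.height ≤ (L.comp P).height := by
  rw [height_comp, height_eq]
  nlinarith [(L 1).pos, P.neg_one_le_height]

theorem not_disjoint_of_comp {K L P : LittleCube 2}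
    (h : ¬ Disjoint (K 0).core ((L.comp P) 0).core) : ¬ Disjoint (K 0).core (L 0).core :=
  fun hd => h (hd.mono_right (LittleInterval.core_comp_subset _ _))

/-- The projections of K and L overlap, so otherwise L would lie under K. Then K would start at or
above the top of L, whereas every square inside L starts strictly below that top. -/
theorem under_of_under_comp_right {K L P : LittleCube 2} (h : AlmostDisjoint K L)
    (hu : Under K (L.comp P)) : Under K L := by
  by_contra hn
  rw [under_iff] at hu
  have hd := not_disjoint_of_comp hu.2
  have hLK : Under L K := by
    by_contra hn'
    exact hd (h.disjoint_of_not_under hn hn')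
  have h1 := le_of_under h.symm hLK
  rw [← height_eq] at h1
  linarith [hu.1, height_comp_lt L P]

/-- A square inside L starts no lower than L and projects inside it, so almost disjointness plays no
part here. -/
theorem under_of_under_comp_left {K L P : LittleCube 2} (hu : Under (L.comp P) K) : Under L K := by
  rw [under_iff] at hu ⊢
  exact ⟨(height_le_comp L P).trans_lt hu.1, fun hd => not_disjoint_of_comp
    (fun h => hu.2 h.symm) hd.symm⟩

theorem under_of_comp {L P Q : LittleCube 2} (hu : Under (L.comp P) (L.comp Q)) : Under P Q := by
  rw [under_iff, height_comp, height_comp, Set.not_disjoint_iff] at hu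
  rw [under_iff, Set.not_disjoint_iff]
  obtain ⟨h, x, h1, h2⟩ := hu
  refine ⟨by nlinarith [(L 1).pos], (L 0).inv x, ?_, ?_⟩
  · exact (LittleInterval.mem_core_comp _ _ _).1 h1
  · exact (LittleInterval.mem_core_comp _ _ _).1 h2

/-- The square `L` comes before `P` in an order, or in a reverse order. -/
def Precedes (rev : Bool) (L P : LittleCube 2) : Prop := if rev then Under P L else Under L P

variable {rev : Bool} {K L P Q : LittleCube 2}

theorem precedes_of_comp_right (h : AlmostDisjoint K L) (hu : Precedes rev K (L.comp P)) :
    Precedes rev K L := by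
  cases rev
  · exact under_of_under_comp_right h hu
  · exact under_of_under_comp_left hu

theorem precedes_of_comp_left (h : AlmostDisjoint K L) (hu : Precedes rev (L.comp P) K) :
    Precedes rev L K := by
  cases rev
  · exact under_of_under_comp_left hu
  · exact under_of_under_comp_right h hu

theorem precedes_of_comp (hu : Precedes rev (L.comp P) (L.comp Q)) : Precedes rev P Q := by
  cases rev
  · exact under_of_comp hu
  · exact under_of_comp hu

theorem AlmostDisjoint.disjoint_of_not_precedes (h : AlmostDisjoint L P)
    (h1 : ¬ Precedes rev L P) (h2 : ¬ Precedes rev P L) : Disjoint (L 0).core (P 0).core := by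
  cases rev
  · exact h.disjoint_of_not_under h1 h2
  · exact h.disjoint_of_not_under h2 h1

end LittleCube

open LittleCube

/-! ## Multisets of labelled squares -/

/-- The head of the first list can be moved to the front of the second one, and induction treats the
tails. The relation R need not be transitive, since only direct comparisons occur. -/
theorem _root_.List.prod_map_eq_of_perm {α M : Type*} [Monoid M] (f : α → M) {D R : α → α → Prop}
    [Std.Symm D] (H : ∀ a b, D a b → ¬ R a b → ¬ R b a → Commute (f a) (f b)) {ℓ ℓ' : List α}
    (hp : ℓ.Perm ℓ') (hD : ℓ.Pairwise D) (h : ℓ.Pairwise fun a b => ¬ R b a)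
    (h' : ℓ'.Pairwise fun a b => ¬ R b a) : (ℓ.map f).prod = (ℓ'.map f).prod := by
  induction ℓ generalizing ℓ' with
  | nil => rw [List.nil_perm.1 hp]
  | cons a t ih =>
    obtain ⟨u, v, rfl⟩ := List.append_of_mem (hp.subset List.mem_cons_self)
    have hp' : t.Perm (u ++ v) := (hp.trans List.perm_middle).cons_inv
    rw [List.pairwise_cons] at hD h
    rw [List.pairwise_append] at h'
    -- An element of u comes after a in the first list and before a in the second, so R holds in
    -- neither direction.
    have hc : Commute (f a) (u.map f).prod := by
      refine Commute.list_prod_right _ _ fun y hy => ?_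
      obtain ⟨b, hb, rfl⟩ := List.mem_map.1 hy
      have hbt : b ∈ t := hp'.symm.subset (List.mem_append_left _ hb)
      exact H a b (hD.1 b hbt) (h'.2.2 b hb a List.mem_cons_self) (h.1 b hbt)
    have huv : (u ++ v).Pairwise fun a b => ¬ R b a := by
      rw [List.pairwise_append]
      exact ⟨h'.1, (List.pairwise_cons.1 h'.2.1).2,
        fun x hx y hy => h'.2.2 x hx y (List.mem_cons_of_mem _ hy)⟩
    rw [List.map_cons, List.prod_cons, ih hp' hD.2 h.2 huv, List.map_append, List.map_append,
      List.prod_append, List.prod_append, List.map_cons, List.prod_cons, ← mul_assoc, hc.eq,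
      mul_assoc]

theorem _root_.Multiset.pairwise_add {α : Type*} {r : α → α → Prop} [Std.Symm r]
    {M N : Multiset α} : (M + N).Pairwise r ↔
      M.Pairwise r ∧ N.Pairwise r ∧ ∀ a ∈ M, ∀ b ∈ N, r a b := by
  induction M, N using Quotient.inductionOn₂ with
  | h ℓ ν =>
    simp only [Multiset.quot_mk_to_coe, Multiset.coe_add, Multiset.pairwise_coe_iff_pairwise,
      List.pairwise_append, Multiset.mem_coe]

/-- Two labelled squares are almost disjoint. -/
def Apart {β : Type} (x y : LittleCube 2 × β) : Prop := AlmostDisjoint x.1 y.1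

instance {β : Type} : Std.Symm (Apart (β := β)) := ⟨fun _ _ h => AlmostDisjoint.symm h⟩

/-- The labelled squares in a multiset are pairwise almost disjoint. -/
abbrev Separated {β : Type} (M : Multiset (LittleCube 2 × β)) : Prop := M.Pairwise Apart

/-- Composition of a labelled square with a square. -/
def inside {β : Type} (L : LittleCube 2) (x : LittleCube 2 × β) : LittleCube 2 × β :=
  (L.comp x.1, x.2)

theorem Separated.inside {β : Type} {N : Multiset (LittleCube 2 × β)} (h : Separated N)
    (L : LittleCube 2) : Separated (N.map (inside L)) := by
  induction N using Quotient.inductionOn with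
  | h ν =>
    simp only [Separated, Multiset.quot_mk_to_coe, Multiset.map_coe,
      Multiset.pairwise_coe_iff_pairwise, List.pairwise_map] at h ⊢
    exact h.imp fun h => AlmostDisjoint.comp_left h L

theorem Separated.add_inside {β : Type} {M N : Multiset (LittleCube 2 × β)} (hM : Separated M)
    (hN : Separated N) {L : LittleCube 2} (h : N ≠ 0 → ∀ x ∈ M, AlmostDisjoint x.1 L) :
    Separated (M + N.map (SCLinks.inside L)) := by
  refine Multiset.pairwise_add.2 ⟨hM, hN.inside L, fun x hx y hy => ?_⟩
  obtain ⟨y, hy, rfl⟩ := Multiset.mem_map.1 hy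
  exact (h (fun h0 => by simp [h0] at hy) x hx).comp_right _

/-! ## Budney's action on multisets of labelled squares -/

/-- The framed knot `L_π f` attached to a labelled square. -/
def knotAt (x : LittleCube 2 × FramedKnot) : FramedKnot := FramedKnot.conj x.1.proj x.2

theorem knotAt_inside (L : LittleCube 2) (x : LittleCube 2 × FramedKnot) :
    knotAt (inside L x) = FramedKnot.conj L.proj (knotAt x) :=
  FramedKnot.conj_comp _ _ _

/-- The list is compatible with the order, or the reverse order, of squares. -/
abbrev Listed (rev : Bool) (ℓ : List (LittleCube 2 × FramedKnot)) : Prop :=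
  ℓ.Pairwise fun x y => ¬ Precedes rev y.1 x.1

theorem exists_listed (rev : Bool) (M : Multiset (LittleCube 2 × FramedKnot)) :
    ∃ ℓ : List _, (ℓ : Multiset _) = M ∧ Listed rev ℓ := by
  classical
  induction M using Quotient.inductionOn with
  | h ℓ =>
  -- Sorting by height, or by minus the height for the reverse order, gives an admissible listing.
  have key : ∀ φ : LittleCube 2 × FramedKnot → ℝ, ∃ ℓ' : List (LittleCube 2 × FramedKnot),
      ℓ'.Perm ℓ ∧ ℓ'.Pairwise fun x y => φ x ≤ φ y := by
    intro φ
    let r : LittleCube 2 × FramedKnot → LittleCube 2 × FramedKnot → Prop := fun x y => φ x ≤ φ y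
    have : Std.Total r := ⟨fun x y => le_total _ _⟩
    have : IsTrans _ r := ⟨fun x y z => le_trans⟩
    exact ⟨_, List.perm_insertionSort r ℓ, List.pairwise_insertionSort r ℓ⟩
  cases rev
  · obtain ⟨ℓ', hp, h⟩ := key fun x => x.1.height
    exact ⟨ℓ', Quotient.sound hp, h.imp fun h hu => absurd hu.1 (not_lt.2 h)⟩
  · obtain ⟨ℓ', hp, h⟩ := key fun x => -x.1.height
    exact ⟨ℓ', Quotient.sound hp, h.imp fun h hu => absurd hu.1 (not_lt.2 (neg_le_neg_iff.1 h))⟩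

/-- Budney's action, and its reverse. -/
def kap (rev : Bool) (M : Multiset (LittleCube 2 × FramedKnot)) : FramedKnot :=
  ((exists_listed rev M).choose.map knotAt).prod

/-- Independence of the choice made in `kap`: for separated squares, any admissible listing computes
it. -/
theorem kap_coe {rev : Bool} {ℓ : List (LittleCube 2 × FramedKnot)}
    (hs : Separated (ℓ : Multiset (LittleCube 2 × FramedKnot))) (h : Listed rev ℓ) :
    kap rev ℓ = (ℓ.map knotAt).prod := by
  obtain ⟨h1, h2⟩ := (exists_listed rev ℓ).choose_spec
  refine (List.prod_map_eq_of_perm knotAt (D := Apart) (R := fun x y => Precedes rev x.1 y.1) ?_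
    (Quotient.exact h1).symm (Multiset.pairwise_coe_iff_pairwise.1 hs) h h2).symm
  intro x y hxy h1 h2
  exact FramedKnot.commute_conj (hxy.disjoint_of_not_precedes h1 h2) _ _

theorem kap_singleton (rev : Bool) (x : LittleCube 2 × FramedKnot) : kap rev {x} = knotAt x := by
  have h := kap_coe (rev := rev) (ℓ := [x]) (Multiset.pairwise_coe_iff_pairwise.2
    (List.pairwise_singleton _ _)) (List.pairwise_singleton _ _)
  rw [Multiset.coe_singleton] at h
  simpa using h

theorem kap_zero (rev : Bool) : kap rev 0 = 1 := by
  have h := kap_coe (rev := rev) (ℓ := []) (Multiset.pairwise_coe_iff_pairwise.2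
    List.Pairwise.nil) List.Pairwise.nil
  rw [Multiset.coe_nil] at h
  simpa using h

theorem prod_knotAt_inside (L : LittleCube 2) (ν : List (LittleCube 2 × FramedKnot)) :
    ((ν.map (inside L)).map knotAt).prod = FramedKnot.conj L.proj (ν.map knotAt).prod := by
  rw [map_list_prod, List.map_map, List.map_map]
  congr 2
  funext x
  exact knotAt_inside L x

theorem Listed.inside {rev : Bool} {ν : List (LittleCube 2 × FramedKnot)} (h : Listed rev ν)
    (L : LittleCube 2) : Listed rev (ν.map (inside L)) := by
  rw [Listed, List.pairwise_map]
  exact h.imp fun h hp => h (precedes_of_comp hp)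

/-- Budney's action is compatible with the insertion of a composite. -/
theorem kap_add_singleton_kap {rev : Bool} {M N : Multiset (LittleCube 2 × FramedKnot)}
    {L : LittleCube 2} (hM : Separated (M + {(L, kap rev N)})) (hN : Separated N) :
    kap rev (M + {(L, kap rev N)}) = kap rev (M + N.map (inside L)) := by
  obtain ⟨ν, rfl, hν⟩ := exists_listed rev N
  obtain ⟨ℓ, hℓ, hl⟩ := exists_listed rev (M + {(L, kap rev (ν : Multiset _))})
  have hmem : (L, kap rev (ν : Multiset _)) ∈ ℓ := by
    rw [← Multiset.mem_coe, hℓ]; simp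
  -- The inserted square is located in an admissible outer listing u, L, v; the block of inner
  -- squares will take its place.
  obtain ⟨u, v, rfl⟩ := List.append_of_mem hmem
  have hMuv : M = (↑(u ++ v) : Multiset _) := by
    have h1 : (↑(u ++ (L, kap rev (ν : Multiset _)) :: v) : Multiset (LittleCube 2 × FramedKnot)) =
        ↑(u ++ v) + {(L, kap rev (ν : Multiset _))} := by
      rw [add_comm, Multiset.singleton_add, Multiset.cons_coe]
      exact Multiset.coe_eq_coe.2 List.perm_middle
    exact (add_right_cancel (hℓ.symm.trans h1))
  have hap : ∀ x ∈ M, AlmostDisjoint x.1 L := fun x hx =>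
    (Multiset.pairwise_add.1 hM).2.2 x hx _ (Multiset.mem_singleton_self _)
  have hsep := Separated.add_inside (Multiset.pairwise_add.1 hM).1 hN fun _ => hap
  have hnew : M + (ν : Multiset (LittleCube 2 × FramedKnot)).map (inside L) =
      ↑(u ++ (ν.map (inside L) ++ v)) := by
    rw [hMuv, Multiset.map_coe, Multiset.coe_add]
    refine Multiset.coe_eq_coe.2 ?_
    rw [List.append_assoc]
    exact List.Perm.append_left _ List.perm_append_comm
  rw [hnew] at hsep ⊢
  rw [← hℓ] at hM ⊢
  have hapu : ∀ x ∈ u, AlmostDisjoint x.1 L := fun x hx =>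
    hap x (by rw [hMuv]; exact List.mem_append_left _ hx)
  have hapv : ∀ x ∈ v, AlmostDisjoint x.1 L := fun x hx =>
    hap x (by rw [hMuv]; exact List.mem_append_right _ hx)
  -- A comparison between an outer square and an inner one implies the same comparison with L, and a
  -- comparison between inner squares can be pulled back along L. A violation in the new list would
  -- therefore come from one in an old list.
  have hl' : Listed rev (u ++ (ν.map (inside L) ++ v)) := by
    simp only [Listed, List.pairwise_append, List.pairwise_cons, List.mem_append, List.mem_map,
      List.mem_cons] at hl ⊢
    refine ⟨hl.1, ⟨hν.inside L, hl.2.1.2, ?_⟩, ?_⟩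
    · rintro _ ⟨y, hy, rfl⟩ z hz hp
      exact hl.2.1.1 z hz (precedes_of_comp_right (hapv z hz) hp)
    · rintro x hx z (⟨y, hy, rfl⟩ | hz)
      · intro hp
        exact hl.2.2 x hx _ (Or.inl rfl) (precedes_of_comp_left (hapu x hx) hp)
      · exact hl.2.2 x hx z (Or.inr hz)
  rw [kap_coe hM hl, kap_coe hsep hl']
  simp only [List.map_append, List.map_cons, List.prod_append, List.prod_cons, prod_knotAt_inside,
    ← kap_coe hN hν]
  rfl

/-- A square under one inside L would be under L itself, hence start below height -1. -/
theorem not_under_comp {K L P : LittleCube 2} (hL : L.MeetsLowerFace) (h : AlmostDisjoint K L) :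
    ¬ Under K (L.comp P) := by
  intro hu
  have h1 := (under_of_under_comp_right h hu).1
  have h2 : L.height = -1 := hL
  linarith [K.neg_one_le_height]

/-! ### Knots inserted through a square that meets the lower face -/

section LowerFace

variable {M N : Multiset (LittleCube 2 × FramedKnot)} {L : LittleCube 2}

/-- No outer square lies under an inner one, so listing all inner squares first is admissible. -/
theorem kap_add_inside (hM : Separated M) (hN : Separated N) (hL : L.MeetsLowerFace)
    (h : ∀ x ∈ M, AlmostDisjoint x.1 L) :
    kap false (M + N.map (inside L)) = FramedKnot.conj L.proj (kap false N) * kap false M := by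
  obtain ⟨ν, rfl, hν⟩ := exists_listed false N
  obtain ⟨ℓ, rfl, hl⟩ := exists_listed false M
  have hsep := hM.add_inside hN fun _ => h
  rw [add_comm, Multiset.map_coe, Multiset.coe_add] at hsep ⊢
  rw [kap_coe hsep, kap_coe hN hν, kap_coe hM hl, List.map_append, List.prod_append,
    prod_knotAt_inside]
  refine List.pairwise_append.2 ⟨hν.inside L, hl, ?_⟩
  rintro _ hx y hy
  obtain ⟨x, hx, rfl⟩ := List.mem_map.1 hx
  exact not_under_comp hL (h y hy)

/-- In the opposite order the inner squares may come last, and their block becomes the right factor.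
-/
theorem kap_rev_add_inside (hM : Separated M) (hN : Separated N) (hL : L.MeetsLowerFace)
    (h : ∀ x ∈ M, AlmostDisjoint x.1 L) :
    kap true (M + N.map (inside L)) = kap true M * FramedKnot.conj L.proj (kap true N) := by
  obtain ⟨ν, rfl, hν⟩ := exists_listed true N
  obtain ⟨ℓ, rfl, hl⟩ := exists_listed true M
  have hsep := hM.add_inside hN fun _ => h
  rw [Multiset.map_coe, Multiset.coe_add] at hsep ⊢
  rw [kap_coe hsep, kap_coe hN hν, kap_coe hM hl, List.map_append, List.prod_append,
    prod_knotAt_inside]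
  refine List.pairwise_append.2 ⟨hl, hν.inside L, ?_⟩
  rintro y hy _ hx
  obtain ⟨x, hx, rfl⟩ := List.mem_map.1 hx
  exact not_under_comp hL (h y hy)

end LowerFace

/-! ## Burke and Koytcheff's action on multisets of labelled squares -/

/-- The projections of the labelled squares in a multiset. -/
def strips (M : Multiset (LittleCube 2 × FramedLink)) : Set (LittleInterval × FramedLink) :=
  (fun y => (y.1.proj, y.2)) '' {y | y ∈ M}

theorem strips_ofFn {k : ℕ} (g : Fin k → LittleCube 2 × FramedLink) :
    strips (List.ofFn g) = Set.range fun i => ((g i).1.proj, (g i).2) := by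
  ext x
  simp only [strips, Multiset.mem_coe, List.mem_ofFn, Set.mem_image, Set.mem_ofPred_eq,
    Set.mem_range, exists_exists_eq_and]

theorem pairwise_disjoint_of_separated {k : ℕ} {g : Fin k → LittleCube 2 × FramedLink}
    (hs : Separated (List.ofFn g : Multiset (LittleCube 2 × FramedLink)))
    (hl : ∀ i, (g i).1.MeetsLowerFace) :
    Pairwise fun i j => Disjoint (g i).1.proj.core (g j).1.proj.core := by
  rw [Separated, Multiset.pairwise_coe_iff_pairwise, List.pairwise_ofFn] at hs
  intro i j hij
  rcases lt_or_gt_of_ne hij with h | h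
  · exact disjoint_of_meetsLowerFace (hs h) (hl i) (hl j)
  · exact (disjoint_of_meetsLowerFace (hs h) (hl j) (hl i)).symm

/-- The concatenation of the empty family; `Classical.epsilon` in `lam` needs an inhabitant. -/
instance : Nonempty FramedLink :=
  ⟨(FramedLink.exists_isConcat (ι := Empty) (x := Empty.elim) (fun i => i.elim)).choose⟩

/-- The concatenation of framed links according to the projections of squares. -/
def lam (M : Multiset (LittleCube 2 × FramedLink)) : FramedLink :=
  Classical.epsilon fun g => FramedLink.IsConcat (strips M) g.toFun

theorem isConcat_lam {M : Multiset (LittleCube 2 × FramedLink)} (hs : Separated M)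
    (hl : ∀ x ∈ M, x.1.MeetsLowerFace) : FramedLink.IsConcat (strips M) (lam M).toFun := by
  refine Classical.epsilon_spec
    (p := fun g : FramedLink => FramedLink.IsConcat (strips M) g.toFun) ?_
  induction M using Quotient.inductionOn with
  | h ℓ =>
  obtain ⟨k, g, rfl⟩ : ∃ k, ∃ g : Fin k → LittleCube 2 × FramedLink, ℓ = List.ofFn g :=
    ⟨_, _, (List.ofFn_get ℓ).symm⟩
  simp only [Multiset.quot_mk_to_coe] at hs hl ⊢
  rw [strips_ofFn]
  exact FramedLink.exists_isConcat (x := fun i => ((g i).1.proj, (g i).2))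
    (pairwise_disjoint_of_separated hs fun i => hl _ (List.mem_ofFn.2 ⟨i, rfl⟩))

theorem linkAct_comp (l p : LittleInterval) (f : Cyl ⊕ Cyl → Cyl) :
    linkAct (l.comp p) f = linkAct l (linkAct p f) := by
  have h : (Prod.map (l.comp p).inv id : Cyl → Cyl) = Prod.map p.inv id ∘ Prod.map l.inv id := by
    funext x
    exact Prod.ext (LittleInterval.inv_comp _ _ _) rfl
  funext x
  simp only [linkAct, Function.comp_apply, h, ← Sum.map_map]
  exact Prod.ext (LittleInterval.app_comp _ _ _) rfl

theorem linkAct_one (f : Cyl ⊕ Cyl → Cyl) : linkAct LittleInterval.one f = f := by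
  have h : (Prod.map LittleInterval.one.inv id : Cyl → Cyl) = id := by
    funext x
    exact Prod.ext (by simp [LittleInterval.inv, LittleInterval.one]) rfl
  have h' : (Prod.map LittleInterval.one.app id : Cyl → Cyl) = id := by
    funext x
    exact Prod.ext (by simp [LittleInterval.app, LittleInterval.one]) rfl
  simp only [linkAct, h, h', Sum.map_id_id, Function.id_comp, Function.comp_id]

/-- Conjugation distributes over the composite because the inner maps l⁻¹ and l cancel. -/
theorem linkAct_sandwich (l : LittleInterval) (k : FramedKnot) (g : FramedLink) (u d : FramedKnot)
    (p : Cyl ⊕ Cyl) :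
    linkAct l (FramedLink.sandwich k g u d).toFun p = knotAct l k.toFun
      (linkAct l g.toFun (Sum.map (knotAct l u.toFun) (knotAct l d.toFun) p)) := by
  have h : ∀ q : Cyl, (Prod.map l.inv id (Prod.map l.app id q : Cyl) : Cyl) = q := fun q =>
    Prod.ext (l.inv_app _) rfl
  rcases p with p | p <;>
    simp only [linkAct, knotAct, FramedLink.sandwich, Function.comp_apply, Sum.map_inl,
      Sum.map_inr, h]

/-! ### Links inserted through a square that meets the lower face -/

section LowerFace

variable {M N : Multiset (LittleCube 2 × FramedLink)} {L : LittleCube 2}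

/-- Over the core of L the strips of M are absent, and those of the inner squares are the strips of
N transported by L. Conjugating the concatenation of N by L therefore gives the refined one there.
-/
theorem lam_inside_apply (hs : Separated (M + N.map (inside L)))
    (hl : ∀ x ∈ M + N.map (inside L), x.1.MeetsLowerFace) (hsN : Separated N)
    (hlN : ∀ x ∈ N, x.1.MeetsLowerFace) (hML : ∀ x ∈ M, Disjoint x.1.proj.core L.proj.core)
    {p : Cyl ⊕ Cyl} (hp : axial p ∈ L.proj.core) :
    (lam (M + N.map (inside L))).toFun p = linkAct L.proj (lam N).toFun p := by
  have h := isConcat_lam hs hl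
  have hN := isConcat_lam hsN hlN
  by_cases hq : ∃ y ∈ N, axial p ∈ (L.comp y.1).proj.core
  · obtain ⟨y, hy, hq⟩ := hq
    rw [h.on_core ((L.comp y.1).proj, y.2) ⟨inside L y, Multiset.mem_add.2
      (Or.inr (Multiset.mem_map_of_mem _ hy)), rfl⟩ p hq]
    have hq' : axial (Sum.map (Prod.map L.proj.inv id) (Prod.map L.proj.inv id) p) ∈
        y.1.proj.core := by
      rw [axial_map_inv]
      exact (LittleInterval.mem_core_comp _ _ _).1 hq
    change linkAct (L.proj.comp y.1.proj) y.2.toFun p = _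
    rw [linkAct_comp]
    exact congrArg (Prod.map L.proj.app id) (hN.on_core (y.1.proj, y.2) ⟨y, hy, rfl⟩ _ hq').symm
  · push Not at hq
    rw [h.off_core]
    · simp only [linkAct, Function.comp_apply]
      rw [hN.off_core, stdLink_map_inv]
      rintro _ ⟨y, hy, rfl⟩ hq'
      rw [axial_map_inv] at hq'
      exact hq y hy ((LittleInterval.mem_core_comp _ _ _).2 hq')
    · rintro _ ⟨x, hx, rfl⟩ hpx
      rcases Multiset.mem_add.1 hx with hx | hx
      · exact Set.disjoint_left.1 (hML x hx) hpx hp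
      · obtain ⟨y, hy, rfl⟩ := Multiset.mem_map.1 hx
        exact hq y hy hpx

theorem sumMap_knotAct_eq (l : LittleInterval) (u d : FramedKnot) {p : Cyl ⊕ Cyl}
    (hp : axial p ∉ l.core) : Sum.map (knotAct l u.toFun) (knotAct l d.toFun) p = p := by
  rcases p with p | p
  · exact congrArg Sum.inl (FramedKnot.knotAct_eq_id l u hp)
  · exact congrArg Sum.inr (FramedKnot.knotAct_eq_id l d hp)

/-- Burke and Koytcheff's action is compatible with the insertion of a composite. -/
theorem lam_add_singleton_sandwich {k u d : FramedKnot}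
    (hs : Separated (M + {(L, FramedLink.sandwich k (lam N) u d)}))
    (hl : ∀ x ∈ M, x.1.MeetsLowerFace) (hL : L.MeetsLowerFace) (hsN : Separated N)
    (hlN : ∀ x ∈ N, x.1.MeetsLowerFace) :
    lam (M + {(L, FramedLink.sandwich k (lam N) u d)}) =
      FramedLink.sandwich (FramedKnot.conj L.proj k) (lam (M + N.map (inside L)))
        (FramedKnot.conj L.proj u) (FramedKnot.conj L.proj d) := by
  have hs' := Multiset.pairwise_add.1 hs
  have hML : ∀ x ∈ M, Disjoint x.1.proj.core L.proj.core := fun x hx =>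
    disjoint_of_meetsLowerFace (hs'.2.2 x hx _ (Multiset.mem_singleton_self _)) (hl x hx) hL
  have hsI := Separated.add_inside hs'.1 hsN fun _ x hx =>
    hs'.2.2 x hx _ (Multiset.mem_singleton_self _)
  have hlI : ∀ x ∈ M + N.map (inside L), x.1.MeetsLowerFace := by
    intro x hx
    rcases Multiset.mem_add.1 hx with hx | hx
    · exact hl x hx
    · obtain ⟨y, hy, rfl⟩ := Multiset.mem_map.1 hx
      exact hL.comp (hlN y hy)
  have hI := isConcat_lam hsI hlI
  -- Concatenations are unique, so it suffices to check that the right-hand side is a concatenation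
  -- for the unrefined data.
  refine FramedLink.ext ((isConcat_lam hs ?_).unique ⟨?_, ?_⟩)
  · intro x hx
    rcases Multiset.mem_add.1 hx with hx | hx
    · exact hl x hx
    · rw [Multiset.mem_singleton.1 hx]; exact hL
  · rintro _ ⟨x, hx, rfl⟩ p hp
    simp only [FramedLink.sandwich, FramedKnot.toFun_conj, Function.comp_apply]
    rcases Multiset.mem_add.1 hx with hx | hx
    · rw [sumMap_knotAct_eq _ _ _ (Set.disjoint_left.1 (hML x hx) hp)]
      have hmem : (x.1.proj, x.2) ∈ strips (M + N.map (inside L)) :=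
        ⟨x, Multiset.mem_add.2 (Or.inl hx), rfl⟩
      rw [FramedKnot.knotAct_eq_id _ _
        (Set.disjoint_left.1 (hML x hx) (hI.fst_mem_core hmem hp)), hI.on_core _ hmem p hp]
    · obtain rfl := Multiset.mem_singleton.1 hx
      -- Over the strip of L, the conjugated knots on the two strands keep the point over that
      -- strip, where the refined concatenation is the conjugate of `lam N`.
      rw [linkAct_sandwich, lam_inside_apply hsI hlI hsN hlN hML]
      exact axial_sumMap (fun _ => FramedKnot.knotAct_mem_core _ _)
        (fun _ => FramedKnot.knotAct_mem_core _ _) hp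
  · intro p hp
    have hpL : axial p ∉ L.proj.core :=
      hp (L.proj, _) ⟨_, Multiset.mem_add.2 (Or.inr (Multiset.mem_singleton_self _)), rfl⟩
    simp only [FramedLink.sandwich, FramedKnot.toFun_conj, Function.comp_apply]
    rw [sumMap_knotAct_eq _ _ _ hpL, hI.off_core p,
      FramedKnot.knotAct_eq_id _ _ (by rwa [stdLink_fst])]
    rintro _ ⟨x, hx, rfl⟩ hpx
    rcases Multiset.mem_add.1 hx with hx | hx
    · exact hp _ ⟨x, Multiset.mem_add.2 (Or.inl hx), rfl⟩ hpx
    · obtain ⟨y, hy, rfl⟩ := Multiset.mem_map.1 hx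
      exact hpL (LittleInterval.core_comp_subset _ _ hpx)

end LowerFace

theorem FramedLink.sandwich_one (g : FramedLink) : FramedLink.sandwich 1 g 1 1 = g := by
  refine FramedLink.ext ?_
  simp only [FramedLink.sandwich, FramedKnot.toFun_one, Sum.map_id_id]
  rfl

/-- The order of the factors matters: the outer knot is on the left after the link and on the right
before it. This matches `kap_rev_add_inside` and `kap_add_inside` respectively. -/
theorem FramedLink.sandwich_sandwich (k k' : FramedKnot) (g : FramedLink) (u d u' d' : FramedKnot) :
    FramedLink.sandwich k (FramedLink.sandwich k' g u d) u' d' =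
      FramedLink.sandwich (k * k') g (u * u') (d * d') := by
  refine FramedLink.ext (funext fun p => ?_)
  rcases p with p | p <;> rfl

theorem lam_singleton_one (g : FramedLink) : lam {(LittleCube.one 2, g)} = g := by
  have hl : (LittleCube.one 2).MeetsLowerFace := by
    simp [MeetsLowerFace, LittleCube.one, LittleInterval.one, LittleInterval.app]
  have hc : LittleInterval.one.core = Set.Ioo (-1 : ℝ) 1 := by
    simp [LittleInterval.core, LittleInterval.one]
  refine FramedLink.ext ((isConcat_lam ?_ ?_).unique ⟨?_, ?_⟩)
  · rw [← Multiset.coe_singleton]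
    exact Multiset.pairwise_coe_iff_pairwise.2 (List.pairwise_singleton _ _)
  · intro x hx
    rw [Multiset.mem_singleton.1 hx]; exact hl
  · rintro _ ⟨x, hx, rfl⟩ p hp
    obtain rfl := Multiset.mem_singleton.1 hx
    exact (congrFun (linkAct_one _) p).symm
  · intro p hp
    have h := hp _ ⟨_, Multiset.mem_singleton_self _, rfl⟩
    exact g.eq_std_of_notMem (hc ▸ h)

/-! ## The operations on families of multisets -/

/-- A family of multisets of labelled squares, one for each colour. -/
abbrev Labelled : Type := ∀ c : Color, Multiset (LittleCube 2 × linkSpaces c)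

/-- The operation with output `s`. -/
def mu : ∀ (s : Color), Labelled → linkSpaces s
  | .o, M => FramedLink.sandwich (kap true (M .updown)) (lam (M .o)) (kap false (M .up))
      (kap false (M .down))
  | .up, M => kap false (M .up)
  | .down, M => kap false (M .down)
  | .updown, M => kap true (M .updown)

/-- The conditions on the squares of an operation with output `s`. -/
def IsLabelling : Color → Labelled → Prop
  | .o, M => (∀ c, Separated (M c)) ∧ (∀ x ∈ M .o, x.1.MeetsLowerFace) ∧
      ∀ c, c ≠ .o → ∀ x ∈ M .o, ∀ y ∈ M c, AlmostDisjoint x.1 y.1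
  | s, M => Separated (M s) ∧ ∀ c, c ≠ s → M c = 0

/-- The multiset of squares of colour `c` of a single labelled square of colour `s`. -/
def single (c : Color) {s : Color} (L : LittleCube 2) (x : linkSpaces s) :
    Multiset (LittleCube 2 × linkSpaces c) :=
  if h : s = c then {(L, cast (congrArg linkSpaces h) x)} else 0

@[simp]
theorem single_self {c : Color} (L : LittleCube 2) (x : linkSpaces c) :
    single c L x = {(L, x)} := by
  simp [single]

theorem single_of_ne {c s : Color} (h : s ≠ c) (L : LittleCube 2) (x : linkSpaces s) :
    single c L x = 0 := by
  simp [single, h]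

theorem mem_single {c s : Color} {L : LittleCube 2} {x : linkSpaces s}
    {y : LittleCube 2 × linkSpaces c} (hy : y ∈ single c L x) : s = c ∧ y.1 = L := by
  by_cases h : s = c
  · subst h
    rw [single_self, Multiset.mem_singleton] at hy
    exact ⟨rfl, by rw [hy]⟩
  · simp [single_of_ne h] at hy

theorem single_inside {c s : Color} (L P : LittleCube 2) (x : linkSpaces s) :
    single c (L.comp P) x = (single c P x).map (inside L) := by
  by_cases h : s = c
  · subst h
    simp [inside]
  · simp [single_of_ne h]

/-- Insertion of the result of an operation with output `o` in another one with output `o`. -/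
theorem mu_open_open {M N : Labelled} {L : LittleCube 2}
    (hM : IsLabelling .o fun c => M c + single c L (mu .o N)) (hN : IsLabelling .o N) :
    mu .o (fun c => M c + single c L (mu .o N)) = mu .o fun c => M c + (N c).map (inside L) := by
  obtain ⟨h1, h2, h3⟩ := hM
  obtain ⟨h4, h5, h6⟩ := hN
  -- The inserted square has colour `o`, so the labelling condition makes it meet the lower face and
  -- be almost disjoint from all the others.
  have hmem : (L, mu .o N) ∈ M .o + single .o L (mu .o N) := by simp
  have hL : L.MeetsLowerFace := h2 _ hmem
  have hsep : ∀ c, Separated (M c) := fun c => (Multiset.pairwise_add.1 (h1 c)).1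
  have hap : ∀ c, c ≠ .o → ∀ x ∈ M c, AlmostDisjoint x.1 L := fun c hc x hx =>
    (h3 c hc _ hmem x (Multiset.mem_add.2 (Or.inl hx))).symm
  have ho : Separated (M .o + single .o L (mu .o N)) := h1 .o
  rw [single_self] at ho
  have e1 : single .up L (mu .o N) = 0 := single_of_ne (by decide) _ _
  have e2 : single .down L (mu .o N) = 0 := single_of_ne (by decide) _ _
  have e3 : single .updown L (mu .o N) = 0 := single_of_ne (by decide) _ _
  change FramedLink.sandwich _ _ _ _ = FramedLink.sandwich _ _ _ _
  beta_reduce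
  rw [e1, e2, e3, single_self, add_zero, add_zero, add_zero]
  have f1 := kap_add_inside (M := M .up) (hsep _) (h4 .up) hL (hap .up (by decide))
  have f2 := kap_add_inside (M := M .down) (hsep _) (h4 .down) hL (hap .down (by decide))
  have f3 := kap_rev_add_inside (M := M .updown) (hsep _) (h4 .updown) hL (hap .updown (by decide))
  have f4 := lam_add_singleton_sandwich (M := M .o) ho
    (fun x hx => h2 x (Multiset.mem_add.2 (Or.inl hx))) hL (h4 .o) h5
  refine Eq.trans ?_ (congr (congr (congr (congrArg FramedLink.sandwich f3) rfl) f1) f2).symm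
  refine Eq.trans (congrArg (fun g => FramedLink.sandwich _ g _ _) f4) ?_
  exact FramedLink.sandwich_sandwich _ _ _ _ _ _ _

/-- Insertion of the result of an operation in another one. -/
theorem mu_add_single {s s' : Color} {M N : Labelled} {L : LittleCube 2}
    (hM : IsLabelling s fun c => M c + single c L (mu s' N)) (hN : IsLabelling s' N) :
    mu s (fun c => M c + single c L (mu s' N)) = mu s fun c => M c + (N c).map (inside L) := by
  have key : ∀ (rev : Bool) (P Q : Multiset (LittleCube 2 × FramedKnot)),
      Separated (P + {(L, kap rev Q)}) → Separated Q →
      kap rev (P + {(L, kap rev Q)}) = kap rev (P + Q.map (inside L)) :=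
    fun rev P Q h h' => kap_add_singleton_kap h h'
  by_cases hs : s = .o
  · subst hs
    by_cases hs' : s' = .o
    · subst hs'
      exact mu_open_open hM hN
    -- A closed operation has squares of its own colour only, so the insertion changes a single
    -- factor of the open composite.
    · have hc : ∀ c, c ≠ s' → M c + single c L (mu s' N) = M c + (N c).map (inside L) := by
        intro c hc
        have h0 : N c = 0 := by
          cases s' with
          | o => exact (hs' rfl).elim
          | up => exact hN.2 c hc
          | down => exact hN.2 c hc
          | updown => exact hN.2 c hc
        rw [single_of_ne (Ne.symm hc), h0, Multiset.map_zero]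
      have h1 : Separated (M s' + single s' L (mu s' N)) := hM.1 s'
      rw [single_self] at h1
      cases s' with
      | o => exact (hs' rfl).elim
      | up =>
        simp only [mu] at hc h1 ⊢
        rw [hc .o (by decide), hc .down (by decide), hc .updown (by decide), single_self]
        congr 1
        exact key _ _ _ h1 hN.1
      | down =>
        simp only [mu] at hc h1 ⊢
        rw [hc .o (by decide), hc .up (by decide), hc .updown (by decide), single_self]
        congr 1
        exact key _ _ _ h1 hN.1
      | updown =>
        simp only [mu] at hc h1 ⊢
        rw [hc .o (by decide), hc .up (by decide), hc .down (by decide), single_self]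
        congr 1
        exact key _ _ _ h1 hN.1
  · have h1 : Separated (M s + single s L (mu s' N)) ∧
        ∀ c, c ≠ s → M c + single c L (mu s' N) = 0 := by
      cases s with
      | o => exact (hs rfl).elim
      | up => exact hM
      | down => exact hM
      | updown => exact hM
    -- With a closed output, a colour other than s has no squares, whereas the inserted square has
    -- colour s'.
    have hss : s' = s := by
      by_contra hne
      have := congrArg Multiset.card (h1.2 s' hne)
      simp at this
    subst hss
    have h2 := h1.1
    rw [single_self] at h2
    cases s' with
    | o => exact (hs rfl).elim
    | up =>
      simp only [mu, single_self] at h2 ⊢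
      exact key _ _ _ h2 hN.1
    | down =>
      simp only [mu, single_self] at h2 ⊢
      exact key _ _ _ h2 hN.1
    | updown =>
      simp only [mu, single_self] at h2 ⊢
      exact key _ _ _ h2 hN.1

theorem mu_single_one {s : Color} (x : linkSpaces s) :
    mu s (fun c => single c (LittleCube.one 2) x) = x := by
  have h : ∀ (rev : Bool) (f : FramedKnot), kap rev {(LittleCube.one 2, f)} = f := fun rev f =>
    (kap_singleton _ _).trans (FramedKnot.conj_one f)
  cases s with
  | o =>
    simp only [mu, single_self]
    rw [single_of_ne (by decide), single_of_ne (by decide), single_of_ne (by decide),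
      lam_singleton_one]
    refine Eq.trans ?_ (FramedLink.sandwich_one x)
    congr 1 <;> exact kap_zero _
  | up => simp only [mu, single_self]; exact h _ _
  | down => simp only [mu, single_self]; exact h _ _
  | updown => simp only [mu, single_self]; exact h _ _

/-! ## Ordering permutations -/

section Orders

variable {k : ℕ} {L : Fin k → LittleCube 2} {σ : Equiv.Perm (Fin k)}

/-- The generated order strictly increases heights. It is therefore irreflexive, and sorting by
height extends it linearly. -/
theorem height_lt_of_transGen {i j : Fin k} (h : Relation.TransGen (Below L) i j) :
    (L i).height < (L j).height := by
  induction h with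
  | single h => exact h.1
  | tail _ h ih => exact ih.trans h.1

theorem exists_orders (L : Fin k → LittleCube 2) : ∃ σ, Orders L σ := by
  refine ⟨Tuple.sort fun i => (L i).height, fun i j h => ?_⟩
  by_contra hij
  exact absurd (height_lt_of_transGen h)
    (not_lt.2 (Tuple.monotone_sort (fun i => (L i).height) (not_lt.1 hij)))

theorem exists_reverseOrders (L : Fin k → LittleCube 2) : ∃ σ, ReverseOrders L σ := by
  refine ⟨Tuple.sort fun i => -(L i).height, fun i j h => ?_⟩
  by_contra hij
  exact absurd (height_lt_of_transGen h) (not_lt.2 (neg_le_neg_iff.1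
    (Tuple.monotone_sort (fun i => -(L i).height) (not_lt.1 hij))))

theorem Orders.not_precedes (h : Orders L σ) {i j : Fin k} (hij : i < j) :
    ¬ Precedes false (L (σ j)) (L (σ i)) := fun hu =>
  lt_asymm hij (h j i (.single hu))

theorem ReverseOrders.not_precedes (h : ReverseOrders L σ) {i j : Fin k} (hij : i < j) :
    ¬ Precedes true (L (σ j)) (L (σ i)) := fun hu =>
  lt_asymm hij (h i j (.single hu))

theorem exists_not_precedes (rev : Bool) (L : Fin k → LittleCube 2) :
    ∃ σ : Equiv.Perm (Fin k), ∀ i j, i < j → ¬ Precedes rev (L (σ j)) (L (σ i)) := by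
  cases rev
  · obtain ⟨σ, h⟩ := exists_orders L
    exact ⟨σ, fun _ _ => h.not_precedes⟩
  · obtain ⟨σ, h⟩ := exists_reverseOrders L
    exact ⟨σ, fun _ _ => h.not_precedes⟩

end Orders

theorem kap_ofFn {k : ℕ} {rev : Bool} {L : Fin k → LittleCube 2} {f : Fin k → FramedKnot}
    (hs : Separated (List.ofFn fun i => (L i, f i) : Multiset (LittleCube 2 × FramedKnot)))
    (σ : Equiv.Perm (Fin k)) (h : ∀ i j, i < j → ¬ Precedes rev (L (σ j)) (L (σ i))) :
    kap rev (List.ofFn fun i => (L i, f i) : Multiset (LittleCube 2 × FramedKnot)) =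
      (List.ofFn fun i => knotAt (L (σ i), f (σ i))).prod := by
  have hp : (List.ofFn fun i => (L i, f i) : Multiset (LittleCube 2 × FramedKnot)) =
      (List.ofFn fun i => (L (σ i), f (σ i)) : Multiset (LittleCube 2 × FramedKnot)) :=
    (Multiset.coe_eq_coe.2 (σ.ofFn_comp_perm fun i => (L i, f i))).symm
  rw [hp] at hs ⊢
  rw [kap_coe hs (List.pairwise_ofFn.2 fun i j => h i j), List.map_ofFn]
  rfl

theorem toFun_kap_ofFn {k : ℕ} {rev : Bool} {L : Fin k → LittleCube 2} {f : Fin k → FramedKnot}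
    (hs : Separated (List.ofFn fun i => (L i, f i) : Multiset (LittleCube 2 × FramedKnot)))
    {σ : Equiv.Perm (Fin k)} (h : ∀ i j, i < j → ¬ Precedes rev (L (σ j)) (L (σ i))) :
    (kap rev (List.ofFn fun i => (L i, f i) : Multiset (LittleCube 2 × FramedKnot))).toFun =
      kappa L σ f := by
  rw [kap_ofFn hs σ h, FramedKnot.toFun_list_prod, List.map_ofFn]
  rfl

/-- For each permutation, the parameters at which it is admissible form a closed set on which `kap`
is one fixed product. These finitely many sets cover the space, and the pieces agree on overlaps
because `kap` is a single function. -/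
theorem continuous_kap {X : Type*} [TopologicalSpace X] {k : ℕ} (rev : Bool)
    {L : X → Fin k → LittleCube 2} {f : X → Fin k → FramedKnot}
    (hL : ∀ i, Continuous fun z => L z i) (hf : ∀ i, Continuous fun z => f z i)
    (hs : ∀ z, Separated (List.ofFn fun i => (L z i, f z i) :
      Multiset (LittleCube 2 × FramedKnot))) :
    Continuous fun z => kap rev (List.ofFn fun i => (L z i, f z i) :
      Multiset (LittleCube 2 × FramedKnot)) := by
  let C : Equiv.Perm (Fin k) → Set X := fun σ =>
    {z | ∀ i j, i < j → ¬ Precedes rev (L z (σ j)) (L z (σ i))}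
  refine (locallyFinite_of_finite C).continuous ?_ (fun σ => ?_) fun σ => ?_
  · refine Set.eq_univ_of_forall fun z => ?_
    obtain ⟨σ, h⟩ := exists_not_precedes rev (L z)
    exact Set.mem_iUnion.2 ⟨σ, h⟩
  · have hC : C σ = ⋂ (i) (j) (_ : i < j), {z | Precedes rev (L z (σ j)) (L z (σ i))}ᶜ := by
      ext z
      simp [C]
    rw [hC]
    refine isClosed_iInter fun i => isClosed_iInter fun j => isClosed_iInter fun _ => ?_
    rw [isClosed_compl_iff]
    cases rev
    · exact isOpen_under.preimage ((hL (σ j)).prodMk (hL (σ i)))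
    · exact isOpen_under.preimage ((hL (σ i)).prodMk (hL (σ j)))
  · refine ContinuousOn.congr (Continuous.continuousOn ?_) fun z hz => kap_ofFn (hs z) σ hz
    simp only [List.ofFn_eq_map]
    refine continuous_list_prod _ fun i _ => ?_
    have h : Continuous fun z => ((L z (σ i)).proj, f z (σ i)) :=
      ((continuous_apply (0 : Fin 2)).comp (hL (σ i))).prodMk (hf (σ i))
    exact FramedKnot.continuous_conj.comp h

/-! ## Concatenation of a tuple of links -/

/-- Closed images may share an endpoint, so the index chosen by `lambda` can be ambiguous there. At
such points every candidate is standard; over a core the choice is forced. -/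
theorem isConcat_lambda {k : ℕ} {l : Fin k → LittleInterval} {f : Fin k → FramedLink}
    (h : Pairwise fun i j => Disjoint (l i).core (l j).core) :
    FramedLink.IsConcat (Set.range fun i => (l i, f i)) (lambda l f) := by
  constructor
  · rintro _ ⟨i, rfl⟩ p hp
    have hex : ∃ i, axial p ∈ (l i).image := ⟨i, (l i).core_subset_image hp⟩
    have hi : hex.choose = i := by
      by_contra hne
      have := (h hne).closure_left (l i).isOpen_core
      rw [LittleInterval.closure_core] at this
      exact Set.disjoint_left.1 this hex.choose_spec hp
    simp only [lambda, dif_pos hex, hi]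
  · intro p hp
    by_cases hex : ∃ i, axial p ∈ (l i).image
    · simp only [lambda, dif_pos hex]
      exact FramedLink.linkAct_eq_std _ _ (hp _ ⟨_, rfl⟩)
    · simp only [lambda, dif_neg hex]

section Lam

variable {k : ℕ}

theorem toFun_lam_ofFn {L : Fin k → LittleCube 2} {f : Fin k → FramedLink}
    (hs : Separated (List.ofFn fun i => (L i, f i) : Multiset (LittleCube 2 × FramedLink)))
    (hl : ∀ i, (L i).MeetsLowerFace) :
    (lam (List.ofFn fun i => (L i, f i) : Multiset (LittleCube 2 × FramedLink))).toFun =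
      lambda (fun i => (L i).proj) f := by
  have h := isConcat_lam hs fun x hx => by
    obtain ⟨i, rfl⟩ := List.mem_ofFn.1 (Multiset.mem_coe.1 hx)
    exact hl i
  rw [strips_ofFn] at h
  exact h.unique (isConcat_lambda (pairwise_disjoint_of_separated hs hl))

theorem continuous_lam {X : Type*} [TopologicalSpace X]
    {L : X → Fin k → LittleCube 2} {f : X → Fin k → FramedLink}
    (hL : ∀ i, Continuous fun z => L z i) (hf : ∀ i, Continuous fun z => f z i)
    (hs : ∀ z, Separated (List.ofFn fun i => (L z i, f z i) :
      Multiset (LittleCube 2 × FramedLink)))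
    (hl : ∀ z i, (L z i).MeetsLowerFace) :
    Continuous fun z => lam (List.ofFn fun i => (L z i, f z i) :
      Multiset (LittleCube 2 × FramedLink)) := by
  refine FramedLink.IsConcat.continuous (ι := Fin k) (x := fun z i => ((L z i).proj, f z i))
    (fun z => pairwise_disjoint_of_separated (hs z) (hl z))
    (fun i => ((continuous_apply (0 : Fin 2)).comp (hL i)).prodMk (hf i)) fun z => ?_
  have h := isConcat_lam (hs z) fun x hx => by
    obtain ⟨i, rfl⟩ := List.mem_ofFn.1 (Multiset.mem_coe.1 hx)
    exact hl z i
  rw [strips_ofFn] at h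
  exact h

end Lam

/-! ## The labelled squares of an operation and its arguments -/

/-- The labelled squares of a configuration, sorted by colours. -/
def parts {ι : Type} [Fintype ι] {t : ι → Color} (L : ι → LittleCube 2)
    (x : ∀ i, linkSpaces (t i)) : Labelled := fun c => ∑ i, single c (L i) (x i)

theorem separated_sum {ι β : Type} {m : ι → Multiset (LittleCube 2 × β)} (s : Finset ι)
    (h : ∀ i, Separated (m i)) (h' : ∀ i j, i ≠ j → ∀ x ∈ m i, ∀ y ∈ m j, Apart x y) :
    Separated (∑ i ∈ s, m i) := by
  classical
  induction s using Finset.induction_on with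
  | empty => exact Multiset.pairwise_zero _
  | insert i s hi ih =>
    rw [Finset.sum_insert hi]
    refine Multiset.pairwise_add.2 ⟨h i, ih, fun x hx y hy => ?_⟩
    obtain ⟨j, hj, hy⟩ := Multiset.mem_sum.1 hy
    exact h' i j (by rintro rfl; exact hi hj) x hx y hy

theorem separated_single (c : Color) {s : Color} (L : LittleCube 2) (x : linkSpaces s) :
    Separated (single c L x) := by
  by_cases h : s = c
  · subst h
    rw [single_self, ← Multiset.coe_singleton]
    exact Multiset.pairwise_coe_iff_pairwise.2 (List.pairwise_singleton _ _)
  · rw [single_of_ne h]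
    exact Multiset.pairwise_zero _

section Parts

variable {n : ℕ} {t : Fin n → Color} {s : Color} {L : Fin n → LittleCube 2}

theorem mem_parts {x : ∀ i, linkSpaces (t i)} {c : Color} {y : LittleCube 2 × linkSpaces c}
    (hy : y ∈ parts L x c) : ∃ i, t i = c ∧ y.1 = L i := by
  obtain ⟨i, _, hy⟩ := Multiset.mem_sum.1 hy
  exact ⟨i, mem_single hy⟩

theorem separated_parts {x : ∀ i, linkSpaces (t i)} {c : Color}
    (h : ∀ i j, t i = c → t j = c → i ≠ j → AlmostDisjoint (L i) (L j)) :
    Separated (parts L x c) := by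
  refine separated_sum _ (fun i => separated_single _ _ _) fun i j hij y hy z hz => ?_
  obtain ⟨h1, h2⟩ := mem_single hy
  obtain ⟨h3, h4⟩ := mem_single hz
  rw [Apart, h2, h4]
  exact h i j h1 h3 hij

theorem isLabelling_parts (h : IsSCL t s L) (x : ∀ i, linkSpaces (t i)) :
    IsLabelling s (parts L x) := by
  have key : ((∀ i, t i = s) ∧ ∀ i j, i ≠ j → AlmostDisjoint (L i) (L j)) →
      Separated (parts L x s) ∧ ∀ c, c ≠ s → parts L x c = 0 := by
    refine fun h => ⟨separated_parts fun i j _ _ => h.2 i j, fun c hc => ?_⟩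
    refine Multiset.eq_zero_of_forall_notMem fun y hy => ?_
    obtain ⟨i, hi, _⟩ := mem_parts hy
    exact hc (hi.symm.trans (h.1 i))
  cases s with
  | o =>
    refine ⟨fun c => separated_parts fun i j hi hj hij => ?_, fun y hy => ?_,
      fun c hc y hy z hz => ?_⟩
    · by_cases hc : c = .o
      · exact (h.1 i (hi.trans hc)).2 j hij.symm
      · exact h.2 c hc i j hi hj hij
    · obtain ⟨i, hi, hyi⟩ := mem_parts hy
      rw [hyi]
      exact (h.1 i hi).1
    · obtain ⟨i, hi, hyi⟩ := mem_parts hy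
      obtain ⟨j, hj, hzj⟩ := mem_parts hz
      rw [hyi, hzj]
      exact (h.1 i hi).2 j (by rintro rfl; exact hc (hj.symm.trans hi))
  | up => exact key h
  | down => exact key h
  | updown => exact key h

theorem parts_act (σ : Equiv.Perm (Fin n)) (x : ∀ i, linkSpaces (t i)) :
    parts (t := t ∘ σ) (L ∘ σ) (fun i => x (σ i)) = parts L x :=
  funext fun c => Equiv.sum_comp σ fun i => single c (L i) (x i)

theorem parts_eq_add (i : Fin n) (x : ∀ i, linkSpaces (t i)) (c : Color) :
    parts L x c = (∑ j : {j : Fin n // j ≠ i}, single c (L j) (x j)) + single c (L i) (x i) := by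
  rw [parts, Fintype.sum_eq_add_sum_subtype_ne _ i, add_comm]

theorem parts_insert {m : ℕ} {u : Fin m → Color} (i : Fin n) (P : Fin m → LittleCube 2)
    (x : ∀ i, linkSpaces (t i)) (w : ∀ r, linkSpaces (u r)) (c : Color) :
    parts (compConfig L i P) (insertDep x i w) c =
      (∑ j : {j : Fin n // j ≠ i}, single c (L j) (x j)) + (parts P w c).map (inside (L i)) := by
  let G : {j : Fin n // j ≠ i} ⊕ Fin m → Multiset (LittleCube 2 × linkSpaces c) :=
    Sum.elim (fun j => single c (L j) (x j)) fun r => single c ((L i).comp (P r)) (w r)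
  have h : ∀ k, single c (compConfig L i P k) (insertDep x i w k) = G ((slot i m).symm k) := by
    intro k
    unfold compConfig insertDep insertAt
    -- The square and its label are read off from the same position; with that position as a
    -- variable, both summands reduce by computation.
    generalize (slot i m).symm k = z
    rcases z with z | z <;> rfl
  have h1 : parts (compConfig L i P) (insertDep x i w) c = ∑ z, G z := by
    rw [← Equiv.sum_comp (slot i m).symm G]
    exact Finset.sum_congr rfl fun k _ => h k
  have h2 : (parts P w c).map (inside (L i)) = ∑ r, (single c (P r) (w r)).map (inside (L i)) :=
    map_sum (Multiset.mapAddMonoidHom (inside (L i))) _ _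
  rw [h1, h2, Fintype.sum_sum_type]
  simp only [G, Sum.elim_inl, Sum.elim_inr, single_inside]

theorem parts_const {c : Color} (x : Fin n → linkSpaces c) :
    parts (t := fun _ => c) L x c = (List.ofFn fun i => (L i, x i) :
      Multiset (LittleCube 2 × linkSpaces c)) := by
  simp only [parts, single_self]
  rw [← Fin.univ_val_map, ← Finset.sum_multiset_singleton]
  rw [← Multiset.coe_mapAddMonoidHom, map_sum]
  simp

theorem parts_sorting (α : ColorSorting t) (x : ∀ i, linkSpaces (t i)) (c : Color) :
    parts L x c = (List.ofFn fun r => (α.cubes c L r, α.entries c x r) :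
      Multiset (LittleCube 2 × linkSpaces c)) := by
  rw [← parts_const]
  -- Indices outside the image of the sorting function have another colour and contribute zero.
  refine (Fintype.sum_of_injective (α.fn c) (α.injective c) _ _ (fun i hi => ?_) fun r => ?_).symm
  · refine single_of_ne (fun h => hi ?_) _ _
    obtain ⟨c', r, hr⟩ := α.cover i
    have hc : c' = c := by rw [← h, ← hr, α.color]
    subst hc
    exact ⟨r, hr⟩
  · rw [single_self, single, dif_pos (α.color c r)]
    rfl

theorem exists_colorSorting (t : Fin n → Color) : Nonempty (ColorSorting t) := by
  let e : ∀ s, Fin (colorCount t s) ≃ {i // t i = s} := fun s => (Fintype.equivFin _).symm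
  exact ⟨{
    fn := fun s i => (e s i).1
    injective := fun s => Subtype.val_injective.comp (e s).injective
    color := fun s i => (e s i).2
    cover := fun j => ⟨t j, (e (t j)).symm ⟨j, rfl⟩, by simp⟩ }⟩

theorem continuous_cubes {X : Type*} [TopologicalSpace X] (α : ColorSorting t) (c : Color)
    (r : Fin (colorCount t c)) :
    Continuous fun p : SCLOp t s × X => α.cubes c p.1.1 r :=
  (continuous_apply _).comp (continuous_subtype_val.comp continuous_fst)

theorem continuous_cast {c c' : Color} (h : c = c') :
    Continuous (cast (congrArg linkSpaces h) : linkSpaces c → linkSpaces c') := by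
  subst h
  exact continuous_id

theorem continuous_entries {X : Type*} [TopologicalSpace X] (α : ColorSorting t) (c : Color)
    (r : Fin (colorCount t c)) :
    Continuous fun p : X × (∀ i, linkSpaces (t i)) => α.entries c p.2 r :=
  (continuous_cast (α.color c r)).comp ((continuous_apply _).comp continuous_snd)

/-- The homeomorphism φ lets one statement serve all three closed colours, whose spaces are
`FramedKnot` only after the colour is evaluated; it is the identity in each application. -/
theorem continuous_kap_parts {c : Color} (rev : Bool)
    (φ : linkSpaces c ≃ₜ FramedKnot) (hs : ∀ (M : SCLOp t s) (x : ∀ i, linkSpaces (t i)),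
      Separated (parts M.1 x c)) :
    Continuous fun p : SCLOp t s × (∀ i, linkSpaces (t i)) =>
      kap rev ((parts p.1.1 p.2 c).map (Prod.map id φ)) := by
  obtain ⟨α⟩ := exists_colorSorting t
  have h : ∀ p : SCLOp t s × (∀ i, linkSpaces (t i)),
      (parts p.1.1 p.2 c).map (Prod.map id φ) =
        (List.ofFn fun r => (α.cubes c p.1.1 r, φ (α.entries c p.2 r)) :
          Multiset (LittleCube 2 × FramedKnot)) := by
    intro p
    rw [parts_sorting α, Multiset.map_coe, List.map_ofFn]
    rfl
  simp only [h]
  refine continuous_kap rev (continuous_cubes α c)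
    (fun r => φ.continuous.comp (continuous_entries α c r)) fun p => ?_
  have := hs p.1 p.2
  rw [parts_sorting α, Separated, Multiset.pairwise_coe_iff_pairwise, List.pairwise_ofFn] at this
  rw [Separated, Multiset.pairwise_coe_iff_pairwise, List.pairwise_ofFn]
  exact this

theorem continuous_mu : Continuous fun p : SCLOp t s × (∀ i, linkSpaces (t i)) =>
    mu s (parts p.1.1 p.2) := by
  have hk : ∀ (rev : Bool) {c : Color} (φ : linkSpaces c ≃ₜ FramedKnot), (∀ (M : SCLOp t s)
      (x : ∀ i, linkSpaces (t i)), Separated (parts M.1 x c)) → _ :=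
    fun rev _ φ h => continuous_kap_parts rev φ h
  have hm : ∀ M : Multiset (LittleCube 2 × FramedKnot),
      M.map (Prod.map id (Homeomorph.refl FramedKnot)) = M := fun M => Multiset.map_id M
  cases s with
  | o =>
    obtain ⟨α⟩ := exists_colorSorting t
    have hlab := fun (M : SCLOp t .o) (x : ∀ i, linkSpaces (t i)) => isLabelling_parts M.2 x
    have hs := fun c (M : SCLOp t .o) (x : ∀ i, linkSpaces (t i)) => (hlab M x).1 c
    have h1 := hk true (c := .updown) (.refl _) (hs _)
    have h2 := hk false (c := .up) (.refl _) (hs _)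
    have h3 := hk false (c := .down) (.refl _) (hs _)
    have h4 : Continuous fun p : SCLOp t .o × (∀ i, linkSpaces (t i)) =>
        lam (parts p.1.1 p.2 .o) := by
      simp only [parts_sorting α]
      refine continuous_lam (continuous_cubes α .o) (continuous_entries α .o) (fun p => ?_)
        fun p r => (p.1.2.1 _ (α.color .o r)).1
      have := hs .o p.1 p.2
      rwa [parts_sorting α] at this
    have := FramedLink.continuous_sandwich h1 h4 h2 h3
    simp only [hm] at this
    exact this
  | up =>
    have := hk false (c := .up) (.refl _) fun M x => (isLabelling_parts M.2 x).1
    simp only [hm] at this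
    exact this
  | down =>
    have := hk false (c := .down) (.refl _) fun M x => (isLabelling_parts M.2 x).1
    simp only [hm] at this
    exact this
  | updown =>
    have := hk true (c := .updown) (.refl _) fun M x => (isLabelling_parts M.2 x).1
    simp only [hm] at this
    exact this

end Parts

/-! ## The algebra -/

/-- The algebra of framed knots and links over the Swiss-Cheese operad for links. -/
def linkAlgebra : OperadAlgebra SCL linkSpaces where
  map {_ _ s} L x := mu s (parts L.1 x)
  continuous_map := continuous_mu
  map_unit s x := by
    refine Eq.trans (congrArg (mu s) (funext fun c => ?_)) (mu_single_one (x 0))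
    simp only [parts, Fin.sum_univ_one]
    rfl
  map_act σ L x := congrArg (mu _) (parts_act σ x)
  map_comp {n m t u s} i a b y w hy := by
    have hb := isLabelling_parts b.2 w
    have ha := isLabelling_parts a.2 y
    have h1 : parts a.1 y = fun c => (∑ j : {j : Fin n // j ≠ i}, single c (a.1 j) (y j)) +
        -- Splitting off position i puts the outer operation in the form required by
        -- `mu_add_single`.
        single c (a.1 i) (mu (t i) (parts b.1 w)) := by
      funext c
      rw [parts_eq_add i, hy]
    rw [h1] at ha ⊢
    rw [mu_add_single ha hb]
    exact congrArg (mu s) (funext fun c => parts_insert i b.1 y w c)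

theorem isMu_linkAlgebra : IsMu linkAlgebra where
  up L f σ h := by
    have hs := (isLabelling_parts L.2 f).1
    have e := parts_const (c := .up) (L := L.1) f
    rw [e] at hs
    change (kap false (parts (t := fun _ => Color.up) L.1 f .up)).toFun = _
    rw [e]
    exact toFun_kap_ofFn hs fun _ _ => h.not_precedes
  down L f σ h := by
    have hs := (isLabelling_parts L.2 f).1
    have e := parts_const (c := .down) (L := L.1) f
    rw [e] at hs
    change (kap false (parts (t := fun _ => Color.down) L.1 f .down)).toFun = _
    rw [e]
    exact toFun_kap_ofFn hs fun _ _ => h.not_precedes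
  updown L f σ h := by
    have hs := (isLabelling_parts L.2 f).1
    have e := parts_const (c := .updown) (L := L.1) f
    rw [e] at hs
    change (kap true (parts (t := fun _ => Color.updown) L.1 f .updown)).toFun = _
    rw [e]
    exact toFun_kap_ofFn hs fun _ _ => h.not_precedes
  open_mono {k} L f := by
    have hs := (isLabelling_parts L.2 f).1 .o
    have e := parts_const (c := .o) (L := L.1) f
    rw [e] at hs
    -- There are no closed squares, so the three knot factors are trivial and only the concatenation
    -- remains.
    have h0 : ∀ c, c ≠ .o → parts (t := fun _ : Fin k => Color.o) L.1 f c = 0 := fun c hc =>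
      Finset.sum_eq_zero fun i _ => single_of_ne hc.symm _ _
    have hk : ∀ rev, kap rev (0 : Multiset (LittleCube 2 × FramedKnot)) = 1 := kap_zero
    change (FramedLink.sandwich (kap true (parts (t := fun _ => Color.o) L.1 f .updown))
      (lam (parts (t := fun _ => Color.o) L.1 f .o))
      (kap false (parts (t := fun _ => Color.o) L.1 f .up))
      (kap false (parts (t := fun _ => Color.o) L.1 f .down))).toFun = _
    rw [h0 .updown (by decide), h0 .up (by decide), h0 .down (by decide), e]
    refine Eq.trans ?_ (toFun_lam_ofFn hs fun i => (L.2.1 i rfl).1)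
    refine congrArg FramedLink.toFun (Eq.trans ?_ (FramedLink.sandwich_one _))
    congr 1 <;> exact hk _
  mixed {n t} L f α σu σd σud hu hd hud := by
    have hs := (isLabelling_parts L.2 f).1
    simp only [parts_sorting α] at hs
    change (FramedLink.sandwich (kap true (parts L.1 f .updown)) (lam (parts L.1 f .o))
      (kap false (parts L.1 f .up)) (kap false (parts L.1 f .down))).toFun = _
    simp only [parts_sorting α]
    have e1 := toFun_kap_ofFn (hs .updown) fun _ _ => hud.not_precedes
    have e2 := toFun_kap_ofFn (hs .up) fun _ _ => hu.not_precedes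
    have e3 := toFun_kap_ofFn (hs .down) fun _ _ => hd.not_precedes
    have e4 := toFun_lam_ofFn (hs .o) fun i => (L.2.1 _ (α.color .o i)).1
    rw [← e1, ← e2, ← e3, ← e4]
    rfl

/-- Each configuration admits ordering permutations and a colour sorting, so the formulas in `IsMu`
determine every value. Knots and links are determined by their underlying maps. -/
theorem IsMu.eq {A B : OperadAlgebra SCL linkSpaces} (hA : IsMu A) (hB : IsMu B) : A = B := by
  have key : ∀ {n : ℕ} {t : Fin n → Color} {s : Color} (L : SCLOp t s) (x : ∀ i, linkSpaces (t i)),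
      A.map (t := t) (s := s) L x = B.map (t := t) (s := s) L x := by
    intro n t s L x
    cases s with
    | o =>
      obtain ⟨α⟩ := exists_colorSorting t
      obtain ⟨σu, hu⟩ := exists_orders (α.cubes .up L.1)
      obtain ⟨σd, hd⟩ := exists_orders (α.cubes .down L.1)
      obtain ⟨σud, hud⟩ := exists_reverseOrders (α.cubes .updown L.1)
      exact FramedLink.ext ((hA.mixed L x α _ _ _ hu hd hud).trans
        (hB.mixed L x α _ _ _ hu hd hud).symm)
    | up =>
      -- A configuration with closed output exists only for constant inputs, so the formula for that
      -- colour applies.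
      obtain rfl : t = fun _ => Color.up := funext L.2.1
      obtain ⟨σ, h⟩ := exists_orders L.1
      exact FramedKnot.ext ((hA.up L x σ h).trans (hB.up L x σ h).symm)
    | down =>
      obtain rfl : t = fun _ => Color.down := funext L.2.1
      obtain ⟨σ, h⟩ := exists_orders L.1
      exact FramedKnot.ext ((hA.down L x σ h).trans (hB.down L x σ h).symm)
    | updown =>
      obtain rfl : t = fun _ => Color.updown := funext L.2.1
      obtain ⟨σ, h⟩ := exists_reverseOrders L.1
      exact FramedKnot.ext ((hA.updown L x σ h).trans (hB.updown L x σ h).symm)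
  refine OperadAlgebra.ext ?_
  funext n t s L x
  exact key L x

end SCLinks

end

theorem theorem3p5 :
    ∃! A : SCLinks.OperadAlgebra SCLinks.SCL SCLinks.linkSpaces, SCLinks.IsMu A :=
  ⟨SCLinks.linkAlgebra, SCLinks.isMu_linkAlgebra, fun _ h => h.eq SCLinks.isMu_linkAlgebra⟩
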